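/- Let $(Y,\omega)$ be a pre-symplectic manifold, i.e. a (finite-dimensional) smooth manifold with a smooth closed $2$-form $\omega$ of constant rank. Let $E=(TY)^\omega=\ker\omega\subset TY$ be its characteristic distribution (a smooth subbundle), $\pi:E^*\to Y$ the dual bundle, and $Y\subset E^*$ the zero section. Choose a smooth splitting $TY=G\oplus E$ with projection $p_G:TY\to E$ along $G$, let $\theta_G$ be the $1$-form on $E^*$ given by $\theta_{G,\alpha}(v)=\alpha\big(p_G(T\pi(v))\big)$ for $v\in T_\alpha E^*$, and put $\omega_{E^*}=\pi^*\omega-d\theta_G$. Let $U\subset E^*$ be any open neighborhood of the zero section on which $\omega_{E^*}$ is non-degenerate, and $\omega_U=\omega_{E^*}|_U$; the pair $(U,\omega_U)$ is a symplectic thickening of $(Y,\omega)$. A smooth vector field $\xi$ on $Y$ is called locally pre-Hamiltonian if $d(\xi\rfloor\omega)=0$, and pre-Hamiltonian if $\xi\rfloor\omega=df$ for some smooth function $f$ on $Y$; a smooth vector field $\Xi$ on $U$ is called locally Hamiltonian if $d(\Xi\rfloor\omega_U)=0$, and Hamiltonian if $\Xi\rfloor\omega_U=dF$ for some smooth function $F$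 on $U$. Theorem. Every locally pre-Hamiltonian vector field $\xi$ on $(Y,\omega)$ extends to a locally Hamiltonian vector field $\Xi$ on $(U,\omega_U)$. Likewise, every pre-Hamiltonian vector field $\xi$ on $(Y,\omega)$ extends to a Hamiltonian vector field $\Xi$ on $(U,\omega_U)$. Here "extends" means that $\Xi(0_x)=T_x o(\xi(x))$ for all $x\in Y$, where $o:Y\to U$, $x\mapsto 0_x$, is the zero section. -/

import Mathlib

open Set Bundle Topology
open scoped Manifold ContDiff

noncomputable section

namespace Presymplectic

section Forms

variable {E : Type*} [NormedAddCommGroup E] [NormedSpace ℝ E]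
  {H : Type*} [TopologicalSpace H] (I : ModelWithCorners ℝ E H)
  {M : Type*} [TopologicalSpace M] [ChartedSpace H M]

variable (M) in
/-- (Not necessarily smooth) differential `k`-forms on a manifold `M`. -/
abbrev Form (k : ℕ) : Type _ := ∀ x : M, TangentSpace I x [⋀^Fin k]→L[ℝ] ℝ

variable (M) in
/-- (Not necessarily smooth) vector fields on a manifold `M`. -/
abbrev VField : Type _ := ∀ x : M, TangentSpace I x

variable {k : ℕ}

/-- The local representative of a form in the preferred chart at `x₀`: the pullback of the form
by the inverse of that chart. -/
def Form.inChart (η : Form I M k) (x₀ : M) (z : E) : E [⋀^Fin k]→L[ℝ] ℝ :=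
  (η ((extChartAt I x₀).symm z)).compContinuousLinearMap
    (mfderivWithin 𝓘(ℝ, E) I (extChartAt I x₀).symm (range I) z)

/-- A form is smooth if all its local representatives are. -/
def Form.Smooth (η : Form I M k) : Prop :=
  ∀ x₀ : M, ContDiffOn ℝ ∞ (η.inChart I x₀) (extChartAt I x₀).target

/-- The exterior derivative of a form on a manifold: at `x`, take the exterior derivative of the
local representative in the chart at `x`, and pull it back by this chart. -/
def Form.d (η : Form I M k) : Form I M (k + 1) := fun x =>
  (extDerivWithin (η.inChart I x) (range I) (extChartAt I x x)).compContinuousLinearMap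
    (mfderiv I 𝓘(ℝ, E) (extChartAt I x) x)

/-- The interior product (contraction) `X ⌟ η`, i.e. `(X ⌟ η)(v₁, …) = η(X, v₁, …)`. -/
def Form.interior (X : VField I M) (η : Form I M (k + 1)) : Form I M k := fun x =>
  ContinuousAlternatingMap.curryLeft (E := E) (η x) (X x)

/-- The differential of a real function, as a `1`-form. -/
def Form.dFun (f : M → ℝ) : Form I M 1 := fun x =>
  ContinuousAlternatingMap.ofSubsingleton ℝ (TangentSpace I x) ℝ (0 : Fin 1) (mfderiv I 𝓘(ℝ, ℝ) f x)

end Forms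

/-- The kernels of a smooth family of skew bilinear forms of constant rank on a vector space have
smooth local frames. -/
lemma exists_kernel_frame {V : Type*} [NormedAddCommGroup V] [NormedSpace ℝ V]
    [FiniteDimensional ℝ V] {r : ℕ} (β : V → V →L[ℝ] V →L[ℝ] ℝ) (U : Set V) (hU : IsOpen U)
    (hβ : ContDiffOn ℝ ∞ β U) (hs : ∀ z ∈ U, ∀ v w, β z v w = -β z w v)
    (hr : ∀ z ∈ U, Module.finrank ℝ (LinearMap.ker (β z : V →ₗ[ℝ] V →L[ℝ] ℝ)) = r)
    (z₀ : V) (hz₀ : z₀ ∈ U) :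
    ∃ (U' : Set V) (s : Fin r → V → V), IsOpen U' ∧ U' ⊆ U ∧ z₀ ∈ U' ∧
      (∀ i, ContDiffOn ℝ ∞ (s i) U') ∧
      ∀ z ∈ U', (∀ i, β z (s i z) = 0) ∧ LinearIndependent ℝ (fun i => s i z) := by
  have : CompleteSpace V := FiniteDimensional.complete ℝ V
  let K := LinearMap.ker (β z₀ : V →ₗ[ℝ] V →L[ℝ] ℝ)
  let b : Module.Basis (Fin r) ℝ K := Module.finBasisOfFinrankEq ℝ K (hr z₀ hz₀)
  obtain ⟨p, hp⟩ := Submodule.exists_isCompl K |>.elim fun W hW =>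
    (⟨(K.projectionOnto W hW), fun k : K => Submodule.projectionOnto_apply_left hW k⟩ :
      ∃ p : V →ₗ[ℝ] K, ∀ k : K, p k = k)
  let τ : V →L[ℝ] (Fin r → ℝ) := LinearMap.toContinuousLinearMap (b.equivFun.toLinearMap ∘ₗ p)
  let σ : (Fin r → ℝ) →L[ℝ] V :=
    LinearMap.toContinuousLinearMap (K.subtype ∘ₗ b.equivFun.symm.toLinearMap)
  have hτσ : ∀ c, τ (σ c) = c := fun c => by
    change b.equivFun (p (b.equivFun.symm c)) = c
    rw [hp, LinearEquiv.apply_symm_apply]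
  have hσK : ∀ c, β z₀ (σ c) = 0 := fun c => (b.equivFun.symm c).2
  have hKσ : ∀ v, β z₀ v = 0 → σ (τ v) = v := fun v hv => by
    have : p v = ⟨v, hv⟩ := hp ⟨v, hv⟩
    change ((b.equivFun.symm (b.equivFun (p v)) : K) : V) = v
    rw [LinearEquiv.symm_apply_apply, this]
  let q : V →L[ℝ] V →L[ℝ] ℝ := ∑ i, (ContinuousLinearMap.smulRight
    ((ContinuousLinearMap.proj i).comp τ) ((ContinuousLinearMap.proj i).comp τ))
  have hq : ∀ v w, q v w = ∑ i, τ v i * τ w i := fun v w => by simp [q]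
  let ρ : V →L[ℝ] V := ContinuousLinearMap.id ℝ V - σ.comp τ
  let A : V → V →L[ℝ] V →L[ℝ] ℝ := fun z =>
    (((ContinuousLinearMap.compL ℝ V V ℝ).flip ρ).comp (β z)) + q
  have hA : ∀ z v w, A z v w = β z v (w - σ (τ w)) + q v w := fun z v w => rfl
  have hAs : ContDiffOn ℝ ∞ A U := (contDiffOn_const.clm_comp hβ).add contDiffOn_const
  have hq0 : ∀ v, (∀ w, q v (σ w) = 0) → τ v = 0 := fun v h => by
    ext i
    simpa [hq, hτσ, Pi.single_apply] using h (Pi.single i 1)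
  have hA0 : (A z₀).IsInvertible := by
    have hinj : Function.Injective (A z₀ : V →ₗ[ℝ] V →L[ℝ] ℝ) := by
      refine (injective_iff_map_eq_zero _).2 fun v hv => ?_
      have hv' : ∀ w, β z₀ v (w - σ (τ w)) + q v w = 0 := fun w => by
        rw [← hA]; exact congrArg (fun f : V →L[ℝ] ℝ => f w) hv
      have h0 : τ v = 0 := hq0 v fun w => by
        simpa [hτσ] using hv' (σ w)
      have h1 : β z₀ v = 0 := by
        ext w
        have h2 := hv' w
        rw [hq, h0] at h2
        have h3 : β z₀ v (σ (τ w)) = 0 := by rw [hs z₀ hz₀, hσK]; simp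
        rw [map_sub, h3] at h2
        simpa using h2
      rw [← hKσ v h1, h0, map_zero]
    have hd : Module.finrank ℝ V = Module.finrank ℝ (V →L[ℝ] ℝ) := by
      rw [← LinearMap.toContinuousLinearMap.finrank_eq (R := ℝ) (M := V →ₗ[ℝ] ℝ)]
      exact (Subspace.dual_finrank_eq).symm
    exact ⟨(LinearEquiv.ofInjectiveOfFinrankEq _ hinj hd).toContinuousLinearEquiv, by ext; rfl⟩
  let U' := U ∩ A ⁻¹' (range ((↑) : (V ≃L[ℝ] (V →L[ℝ] ℝ)) → V →L[ℝ] V →L[ℝ] ℝ))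
  have hU' : IsOpen U' := hAs.continuousOn.isOpen_inter_preimage hU ContinuousLinearEquiv.isOpen
  have hinv : ∀ z ∈ U', (A z).IsInvertible := fun z hz => hz.2
  refine ⟨U', fun i z => (A z).inverse (q (σ (Pi.single i 1))), hU', inter_subset_left,
    ⟨hz₀, hA0⟩, ?_, ?_⟩
  · intro i z hz
    have h1 : ContDiffWithinAt ℝ ∞ A U' z := (hAs z hz.1).mono inter_subset_left
    exact (((hinv z hz).contDiffAt_map_inverse).comp_contDiffWithinAt z h1).clm_apply
      contDiffWithinAt_const
  · intro z hz
    have hinj : Function.Injective (A z) := by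
      obtain ⟨e, he⟩ := hinv z hz
      rw [← he]; exact e.injective
    have hAk : ∀ v, β z v = 0 → A z v = q (σ (τ v)) := fun v hv => by
      ext w; rw [hA, hv, hq, hq, hτσ]; simp
    -- the kernel of `β z` is mapped bijectively to `ℝ ^ r` by `τ`
    let κ : LinearMap.ker (β z : V →ₗ[ℝ] V →L[ℝ] ℝ) →ₗ[ℝ] (Fin r → ℝ) :=
      (τ : V →ₗ[ℝ] (Fin r → ℝ)) ∘ₗ Submodule.subtype _
    have hκ : Function.Injective κ := by
      refine (injective_iff_map_eq_zero _).2 fun v hv => ?_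
      have hv' : τ v = 0 := hv
      have : A z v = 0 := by rw [hAk v v.2, hv']; simp
      exact Subtype.ext (hinj (by rw [this]; simp))
    have hκ' : Function.Surjective κ :=
      (LinearMap.injective_iff_surjective_of_finrank_eq_finrank
        (by rw [hr z hz.1]; simp)).1 hκ
    have key : ∀ i, ∃ v, β z v = 0 ∧ τ v = Pi.single i 1 ∧
        (A z).inverse (q (σ (Pi.single i 1))) = v := fun i => by
      obtain ⟨v, hv⟩ := hκ' (Pi.single i 1)
      have hv' : τ v = Pi.single i 1 := hv
      refine ⟨v, v.2, hv', ?_⟩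
      rw [← hv', ← hAk v v.2, (hinv z hz).inverse_apply_self]
    refine ⟨fun i => ?_, ?_⟩
    · obtain ⟨v, hv, -, h⟩ := key i
      change β z ((A z).inverse (q (σ (Pi.single i 1)))) = 0
      rw [h, hv]
    · apply LinearIndependent.of_comp (τ : V →ₗ[ℝ] (Fin r → ℝ))
      have : (τ : V →ₗ[ℝ] (Fin r → ℝ)) ∘ (fun i => (A z).inverse (q (σ (Pi.single i 1)))) =
          fun i => Pi.basisFun ℝ (Fin r) i := by
        funext i
        obtain ⟨v, -, hv, h⟩ := key i
        simp [h, hv]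
      rw [this]
      exact (Pi.basisFun ℝ (Fin r)).linearIndependent

section Null

variable {E : Type*} [NormedAddCommGroup E] [NormedSpace ℝ E]
  {H : Type*} [TopologicalSpace H] (I : ModelWithCorners ℝ E H)
  {M : Type*} [TopologicalSpace M] [ChartedSpace H M]

/-- The null space (kernel) of a `2`-form at a point. -/
def Form.null (η : Form I M 2) (x : M) : Submodule ℝ (TangentSpace I x) where
  carrier := {v | ∀ w, η x ![v, w] = 0}
  zero_mem' := fun w => (η x).map_coord_zero 0 rfl
  add_mem' := by
    intro a b ha hb w
    have := (η x).cons_add ![w] a b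
    simp only [Set.mem_ofPred_eq] at ha hb
    simpa [ha w, hb w] using this
  smul_mem' := by
    intro c a ha w
    have := (η x).cons_smul ![w] c a
    simp only [Set.mem_ofPred_eq] at ha
    simpa [ha w] using this

end Null

variable (V : Type*) [NormedAddCommGroup V] [NormedSpace ℝ V]
  (Y : Type*) [TopologicalSpace Y] [ChartedSpace V Y] [IsManifold 𝓘(ℝ, V) ∞ Y]

/-- A pre-symplectic form on `Y`: a smooth closed `2`-form of constant rank, here `dim V - r`. -/
structure PresymplecticForm (r : ℕ) where
  form : Form 𝓘(ℝ, V) Y 2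
  smooth : form.Smooth
  closed : ∀ x, form.d 𝓘(ℝ, V) x = 0
  finrank_null : ∀ x, Module.finrank ℝ (form.null 𝓘(ℝ, V) x) = r

variable {V Y} {r : ℕ} (P : PresymplecticForm V Y r)

namespace PresymplecticForm

/-- The characteristic distribution `E = (TY)^ω ⊆ TY`. -/
def E (x : Y) : Submodule ℝ (TangentSpace 𝓘(ℝ, V) x) := P.form.null 𝓘(ℝ, V) x

/-- The fibre at `x` of the dual bundle `E^*`. -/
def EDual (x : Y) : Type _ := P.E x →L[ℝ] ℝ

instance (x : Y) : AddCommGroup (P.EDual x) := inferInstanceAs (AddCommGroup (P.E x →L[ℝ] ℝ))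
instance (x : Y) : Module ℝ (P.EDual x) := inferInstanceAs (Module ℝ (P.E x →L[ℝ] ℝ))
instance (x : Y) : TopologicalSpace (P.EDual x) :=
  inferInstanceAs (TopologicalSpace (P.E x →L[ℝ] ℝ))
instance (x : Y) : IsTopologicalAddGroup (P.EDual x) :=
  inferInstanceAs (IsTopologicalAddGroup (P.E x →L[ℝ] ℝ))
instance (x : Y) : ContinuousSMul ℝ (P.EDual x) :=
  inferInstanceAs (ContinuousSMul ℝ (P.E x →L[ℝ] ℝ))
instance (x : Y) : FunLike (P.EDual x) (P.E x) ℝ :=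
  inferInstanceAs (FunLike (P.E x →L[ℝ] ℝ) (P.E x) ℝ)

instance (x : Y) : LinearMapClass (P.EDual x) ℝ (P.E x) ℝ :=
  inferInstanceAs (LinearMapClass (P.E x →L[ℝ] ℝ) ℝ (P.E x) ℝ)

instance (x : Y) : T2Space (TangentSpace 𝓘(ℝ, V) x) := inferInstanceAs (T2Space V)
instance (x : Y) : T2Space (P.EDual x) :=  inferInstanceAs (T2Space (P.E x →L[ℝ] ℝ))

instance [FiniteDimensional ℝ V] (x : Y) : FiniteDimensional ℝ (TangentSpace 𝓘(ℝ, V) x) := inferInstanceAs (FiniteDimensional ℝ V)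

instance [FiniteDimensional ℝ V] (x : Y) : FiniteDimensional ℝ (P.EDual x) := by
  have : FiniteDimensional ℝ (P.E x →L[ℝ] ℝ) := inferInstance
  exact this

/-- A local frame of the distribution `E`: smooth vector fields on an open set which form a basis
of `E` at each point of this open set. -/
structure Frame where
  baseSet : Set Y
  isOpen_baseSet : IsOpen baseSet
  vec : Fin r → ∀ x : Y, P.E x
  smooth : ∀ i, ContMDiffOn 𝓘(ℝ, V) 𝓘(ℝ, V).tangent ∞
    (fun x => (⟨x, vec i x⟩ : TangentBundle 𝓘(ℝ, V) Y)) baseSet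
  linearIndependent : ∀ x ∈ baseSet, LinearIndependent ℝ (fun i => vec i x)

variable {P} [FiniteDimensional ℝ V]

/-- The basis of `E` at a point given by a local frame. -/
def Frame.basis (e : P.Frame) (x : Y) (hx : x ∈ e.baseSet) : Module.Basis (Fin r) ℝ (P.E x) :=
  Module.Basis.mk (e.linearIndependent x hx)
    (ge_of_eq <| (e.linearIndependent x hx).span_eq_top_of_card_eq_finrank'
      (by rw [Fintype.card_fin]; exact (P.finrank_null x).symm))

lemma Frame.basis_apply (e : P.Frame) (x : Y) (hx : x ∈ e.baseSet) (i : Fin r) :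
    e.basis x hx i = e.vec i x := by
  simp [Frame.basis]

/-- Regard a linear functional on `E` at `x` as a point of the fibre of `E^*`. -/
def EDual.mk {x : Y} (α : P.E x →L[ℝ] ℝ) : P.EDual x := α

open Classical in
/-- The functional on `E` at `x` with prescribed values on a local frame. -/
def Frame.functional (e : P.Frame) (x : Y) (c : Fin r → ℝ) : P.EDual x :=
  if h : x ∈ e.baseSet then
    EDual.mk (LinearMap.toContinuousLinearMap ((e.basis x h).constr ℝ c))
  else 0

lemma Frame.functional_vec (e : P.Frame) (x : Y) (hx : x ∈ e.baseSet) (c : Fin r → ℝ) (i : Fin r) :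
    e.functional x c (e.vec i x) = c i := by
  rw [Frame.functional, dif_pos hx, ← e.basis_apply x hx]
  exact (e.basis x hx).constr_basis ℝ c i

lemma Frame.ext_functional (e : P.Frame) (x : Y) (hx : x ∈ e.baseSet) (α β : P.EDual x)
    (h : ∀ i, α (e.vec i x) = β (e.vec i x)) : α = β := by
  refine ContinuousLinearMap.coe_injective (M₁ := P.E x) (M₂ := ℝ) ?_
  refine (e.basis x hx).ext fun i => ?_
  rw [e.basis_apply]
  exact h i

/-- The local trivialization of `E^*` dual to a local frame `e` of `E`; it sends `α` to the tuple
of the `α (e i)`. -/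
def Frame.pretriv (e : P.Frame) :
    Pretrivialization (Fin r → ℝ) (π (Fin r → ℝ) P.EDual) where
  toFun p := (p.1, fun i => p.2 (e.vec i p.1))
  invFun q := ⟨q.1, e.functional q.1 q.2⟩
  source := π (Fin r → ℝ) P.EDual ⁻¹' e.baseSet
  target := e.baseSet ×ˢ univ
  map_source' := fun _ hp => ⟨hp, mem_univ _⟩
  map_target' := fun _ hq => hq.1
  left_inv' := by
    rintro ⟨x, α⟩ hx
    exact congrArg (TotalSpace.mk x)
      (e.ext_functional x hx _ _ fun i => e.functional_vec x hx _ i)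
  right_inv' := by
    rintro ⟨x, c⟩ ⟨hx, -⟩
    exact congrArg (Prod.mk x) (funext fun i => e.functional_vec x hx c i)
  open_target := e.isOpen_baseSet.prod isOpen_univ
  baseSet := e.baseSet
  open_baseSet := e.isOpen_baseSet
  source_eq := rfl
  target_eq := rfl
  proj_toFun := fun _ _ => rfl

lemma Frame.pretriv_apply (e : P.Frame) (x : Y) (α : P.EDual x) :
    e.pretriv ⟨x, α⟩ = (x, fun i => α (e.vec i x)) := rfl

instance (e : P.Frame) : e.pretriv.IsLinear ℝ where
  linear _ _ := ⟨fun _ _ => rfl, fun _ _ => rfl⟩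

lemma Frame.pretriv_symm_apply (e : P.Frame) (x : Y) (hx : x ∈ e.baseSet) (c : Fin r → ℝ)
    (v : P.E x) : (e.pretriv.symm x c : P.EDual x) v = ∑ i, (e.basis x hx).repr v i * c i := by
  have h1 : ∀ i, (e.pretriv.symm x c : P.EDual x) (e.vec i x) = c i := by
    intro i
    have := e.pretriv.apply_mk_symm (b := x) hx c
    rw [e.pretriv_apply] at this
    exact congrFun (congrArg Prod.snd this) i
  conv_lhs => rw [← (e.basis x hx).sum_repr v]
  rw [map_sum]
  refine Finset.sum_congr rfl fun i _ => ?_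
  rw [map_smul, e.basis_apply, h1, smul_eq_mul]

/-- The coordinates of the vectors of one local frame in another one are smooth. -/
lemma Frame.contMDiffAt_repr (e e' : P.Frame) (j i : Fin r) (x₀ : Y) (hx₀ : x₀ ∈ e.baseSet)
    (hx₀' : x₀ ∈ e'.baseSet) (a : Y → ℝ)
    (ha : ∀ x (hx : x ∈ e.baseSet), a x = (e.basis x hx).repr (e'.vec j x) i) :
    ContMDiffAt 𝓘(ℝ, V) 𝓘(ℝ, ℝ) ∞ a x₀ := by
  let T := trivializationAt V (TangentSpace 𝓘(ℝ, V)) x₀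
  let t : ∀ x : Y, TangentSpace 𝓘(ℝ, V) x →ₗ[ℝ] V := fun x => T.linearMapAt ℝ x
  have hT : x₀ ∈ T.baseSet := mem_baseSet_trivializationAt V _ x₀
  have hsm : ∀ (f : P.Frame) (k : Fin r), x₀ ∈ f.baseSet →
      ContMDiffAt 𝓘(ℝ, V) 𝓘(ℝ, V) ∞ (fun x => t x (f.vec k x)) x₀ := by
    intro f k hf
    have h1 := (f.smooth k).contMDiffAt (f.isOpen_baseSet.mem_nhds hf)
    have h2 := (T.contMDiffAt_section_iff hT).1 h1
    refine h2.congr_of_eventuallyEq ?_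
    filter_upwards [T.open_baseSet.mem_nhds hT] with x hx
    exact congrFun (T.coe_linearMapAt_of_mem hx) _
  have hli : LinearIndependent ℝ (fun k => t x₀ (e.vec k x₀)) := by
    have h1 : LinearIndependent ℝ (fun k => (e.vec k x₀ : TangentSpace 𝓘(ℝ, V) x₀)) :=
      (e.linearIndependent x₀ hx₀).map' (P.E x₀).subtype (Submodule.ker_subtype _)
    refine h1.map' (t x₀) ?_
    have h2 : t x₀ = (T.linearEquivAt ℝ x₀ hT : TangentSpace 𝓘(ℝ, V) x₀ →ₗ[ℝ] V) :=
      T.linearMapAt_def_of_mem hT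
    rw [h2]
    exact LinearEquiv.ker _
  let u : (Fin r → ℝ) →ₗ[ℝ] V := Fintype.linearCombination ℝ (fun k => t x₀ (e.vec k x₀))
  obtain ⟨L, hL⟩ := u.exists_leftInverse_of_injective
    (LinearMap.ker_eq_bot.2 (linearIndependent_iff_injective_fintypeLinearCombination.1 hli))
  let L' : V →L[ℝ] (Fin r → ℝ) := LinearMap.toContinuousLinearMap L
  let N : Y → (Fin r → ℝ) →L[ℝ] (Fin r → ℝ) := fun x =>
    ∑ k, (ContinuousLinearMap.proj k : (Fin r → ℝ) →L[ℝ] ℝ).smulRight (L' (t x (e.vec k x)))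
  have hNa : ∀ x c, N x c = ∑ k, c k • L' (t x (e.vec k x)) := fun x c => by simp [N]
  have hN : ContMDiffAt 𝓘(ℝ, V) 𝓘(ℝ, (Fin r → ℝ) →L[ℝ] (Fin r → ℝ)) ∞ N x₀ := by
    refine contMDiffAt_finsetSum fun k _ => ?_
    have h1 : ContMDiffAt 𝓘(ℝ, V) 𝓘(ℝ, Fin r → ℝ) ∞ (fun x => L' (t x (e.vec k x))) x₀ :=
      L'.contMDiff.contMDiffAt.comp x₀ (hsm e k hx₀)
    exact (ContinuousLinearMap.smulRightL ℝ (Fin r → ℝ) (Fin r → ℝ)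
      (ContinuousLinearMap.proj k)).contMDiff.contMDiffAt.comp x₀ h1
  have hN0 : N x₀ = (ContinuousLinearEquiv.refl ℝ (Fin r → ℝ) :
      (Fin r → ℝ) →L[ℝ] (Fin r → ℝ)) := by
    ext1 c
    have h1 : L (u c) = c := LinearMap.congr_fun hL c
    rw [hNa]
    simpa [u, Fintype.linearCombination_apply, L'] using h1
  have hinv : ∀ᶠ x in 𝓝 x₀, (N x).IsInvertible := by
    have h1 := (ContinuousLinearEquiv.refl ℝ (Fin r → ℝ)).nhds
    rw [← hN0] at h1
    exact hN.continuousAt h1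
  have hfin : ContMDiffAt 𝓘(ℝ, V) 𝓘(ℝ, ℝ) ∞
      (fun x => (N x).inverse (L' (t x (e'.vec j x))) i) x₀ := by
    have h0 : (N x₀).IsInvertible := ⟨_, hN0.symm⟩
    have h1 := h0.contDiffAt_map_inverse (n := ∞).contMDiffAt.comp x₀ hN
    have h2 := h1.clm_apply (L'.contMDiff.contMDiffAt.comp x₀ (hsm e' j hx₀'))
    exact (ContinuousLinearMap.proj (R := ℝ) (φ := fun _ : Fin r => ℝ)
      i).contMDiff.contMDiffAt.comp x₀ h2
  refine hfin.congr_of_eventuallyEq ?_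
  filter_upwards [hinv, e.isOpen_baseSet.mem_nhds hx₀] with x hx hxe
  have h1 : N x (fun k => (e.basis x hxe).repr (e'.vec j x) k) = L' (t x (e'.vec j x)) := by
    have h2 := congrArg (fun v : P.E x => L' (t x v)) ((e.basis x hxe).sum_repr (e'.vec j x))
    rw [hNa, ← h2]
    simp [e.basis_apply]
  rw [ha x hxe, ← h1, hx.inverse_apply_self]

/-- An alternating `2`-form as a bilinear form. -/
def Form.bilin {E : Type*} [NormedAddCommGroup E] [NormedSpace ℝ E]
    (B : E [⋀^Fin 2]→L[ℝ] ℝ) : E →L[ℝ] E →L[ℝ] ℝ :=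
  ((ContinuousAlternatingMap.ofSubsingletonLIE (𝕜 := ℝ) (E := E) (F := ℝ)
      (0 : Fin 1)).symm : (E [⋀^Fin 1]→L[ℝ] ℝ) →L[ℝ] (E →L[ℝ] ℝ)).comp B.curryLeft

lemma Form.bilin_apply {E : Type*} [NormedAddCommGroup E] [NormedSpace ℝ E]
    (B : E [⋀^Fin 2]→L[ℝ] ℝ) (v w : E) : Form.bilin B v w = B ![v, w] := by
  have h : (fun _ : Fin 1 => w) = ![w] := by ext i; simp
  change B (Matrix.vecCons v (fun _ : Fin 1 => w)) = _
  rw [h]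

lemma Form.contDiffOn_bilin {E : Type*} [NormedAddCommGroup E] [NormedSpace ℝ E]
    {B : E → E [⋀^Fin 2]→L[ℝ] ℝ} {s : Set E} (hB : ContDiffOn ℝ ∞ B s) :
    ContDiffOn ℝ ∞ (fun z => Form.bilin (B z)) s := by
  have h : ContDiff ℝ ∞ (fun B : E [⋀^Fin (1 + 1)]→L[ℝ] ℝ => B.curryLeft) :=
    LinearIsometry.contDiff (𝕜 := ℝ) (E := E [⋀^Fin (1 + 1)]→L[ℝ] ℝ)
      (F := E →L[ℝ] E [⋀^Fin 1]→L[ℝ] ℝ) ContinuousAlternatingMap.curryLeftLI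
  have h' : ContDiffOn ℝ ∞ (fun z => (B z).curryLeft) s := h.comp_contDiffOn hB
  exact contDiffOn_const.clm_comp h'

/-- Local frames of `E` exist around each point, because `ω` has constant rank. -/
lemma exists_frame (x₀ : Y) : ∃ e : P.Frame, x₀ ∈ e.baseSet := by
  classical
  let φ := extChartAt 𝓘(ℝ, V) x₀
  let T := trivializationAt V (TangentSpace 𝓘(ℝ, V)) x₀
  have hTb : T.baseSet = φ.source := by simp [T, φ]
  let β : V → V →L[ℝ] V →L[ℝ] ℝ := fun z => Form.bilin (P.form.inChart 𝓘(ℝ, V) x₀ z)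
  have hβa : ∀ x ∈ φ.source, ∀ v w, β (φ x) v w = P.form x ![T.symmL ℝ x v, T.symmL ℝ x w] := by
    intro x hx v w
    have hx' : x ∈ (chartAt V x₀).source := by simpa [φ] using hx
    have key : ∀ y (_ : y = x) (D : V →L[ℝ] V), D = T.symmL ℝ x →
        (P.form y : V [⋀^Fin 2]→L[ℝ] ℝ) ![D v, D w] = P.form x ![T.symmL ℝ x v, T.symmL ℝ x w] := by
      rintro y rfl D rfl
      rfl
    refine (Form.bilin_apply _ v w).trans ?_
    have h1 := key _ (φ.left_inv hx) _ (TangentBundle.symmL_trivializationAt (I := 𝓘(ℝ, V)) hx').symm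
    refine Eq.trans ?_ h1
    change (P.form (φ.symm (φ x)) : V [⋀^Fin 2]→L[ℝ] ℝ) _ = _
    congr 1
    ext i : 1
    fin_cases i <;> rfl
  have hτ : ∀ x ∈ φ.source, ∃ τ : V ≃ₗ[ℝ] TangentSpace 𝓘(ℝ, V) x, ∀ v, τ v = T.symmL ℝ x v := by
    intro x hx
    refine ⟨(T.linearEquivAt ℝ x (hTb ▸ hx)).symm, fun v => ?_⟩
    rw [T.symmL_apply (hTb ▸ hx)]
    rfl
  have hmem : ∀ x ∈ φ.source, ∀ v, β (φ x) v = 0 ↔ T.symmL ℝ x v ∈ P.E x := by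
    intro x hx v
    obtain ⟨τ, hτ⟩ := hτ x hx
    constructor
    · intro h w
      have h1 := hβa x hx v (τ.symm w)
      rw [h, ← hτ (τ.symm w), τ.apply_symm_apply] at h1
      exact h1.symm
    · intro h
      ext w
      rw [hβa x hx]
      exact h _
  have hsm : ContDiffOn ℝ ∞ β φ.target := Form.contDiffOn_bilin (P.smooth x₀)
  have hskew : ∀ z ∈ φ.target, ∀ v w, β z v w = -β z w v := by
    intro z _ v w
    simp only [β, Form.bilin_apply]
    have := (P.form.inChart 𝓘(ℝ, V) x₀ z).toAlternatingMap.map_swap ![v, w]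
      (i := 0) (j := 1) (by decide)
    have h2 : ![v, w] ∘ (Equiv.swap (0 : Fin 2) 1) = ![w, v] := by
      ext i : 1
      fin_cases i <;> rfl
    rw [h2] at this
    have h3 : (P.form.inChart 𝓘(ℝ, V) x₀ z) ![w, v] = -(P.form.inChart 𝓘(ℝ, V) x₀ z) ![v, w] := this
    rw [h3, neg_neg]
  have hrank : ∀ z ∈ φ.target,
      Module.finrank ℝ (LinearMap.ker (β z : V →ₗ[ℝ] V →L[ℝ] ℝ)) = r := by
    intro z hz
    have hx : φ.symm z ∈ φ.source := φ.map_target hz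
    obtain ⟨τ, hτ⟩ := hτ _ hx
    suffices hmap : Submodule.map (τ : V →ₗ[ℝ] TangentSpace 𝓘(ℝ, V) (φ.symm z))
        (LinearMap.ker (β z : V →ₗ[ℝ] V →L[ℝ] ℝ)) = P.form.null 𝓘(ℝ, V) (φ.symm z) by
      rw [← P.finrank_null (φ.symm z), ← hmap]
      exact (τ.submoduleMap _).finrank_eq
    ext w
    constructor
    · rintro ⟨v, hv, rfl⟩
      have hv' : β z v = 0 := hv
      rw [← φ.right_inv hz] at hv'
      have := (hmem _ hx v).1 hv'
      rw [← hτ] at this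
      exact this
    · intro hw
      refine ⟨τ.symm w, ?_, τ.apply_symm_apply w⟩
      have h1 : T.symmL ℝ (φ.symm z) (τ.symm w) ∈ P.E (φ.symm z) := by
        rw [← hτ, τ.apply_symm_apply]; exact hw
      have h2 := (hmem _ hx _).2 h1
      rw [φ.right_inv hz] at h2
      exact h2
  obtain ⟨U', s, hU', hU's, hz₀, hss, hsU⟩ := exists_kernel_frame β φ.target
    (isOpen_extChartAt_target x₀) hsm hskew hrank (φ x₀) (mem_extChartAt_target x₀)
  let b := φ.source ∩ φ ⁻¹' U'
  have hmem' : ∀ x ∈ b, ∀ i, T.symmL ℝ x (s i (φ x)) ∈ P.E x := fun x hx i =>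
    (hmem x hx.1 _).1 ((hsU _ hx.2).1 i)
  have hb : IsOpen b := (continuousOn_extChartAt x₀).isOpen_inter_preimage
    (isOpen_extChartAt_source x₀) hU'
  refine ⟨⟨b, hb, fun i x => if hx : x ∈ b then ⟨T.symmL ℝ x (s i (φ x)), hmem' x hx i⟩ else 0,
    ?_, ?_⟩, mem_extChartAt_source x₀, hz₀⟩
  · intro i
    refine (T.contMDiffOn_section_iff hb (hTb ▸ inter_subset_left)).2 ?_
    have h1 : ContMDiffOn 𝓘(ℝ, V) 𝓘(ℝ, V) ∞ (fun x => s i (φ x)) b :=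
      (hss i).contMDiffOn.comp ((contMDiffOn_extChartAt (n := ∞)).mono
        (by intro x hx; simpa [φ] using hx.1)) fun x hx => hx.2
    refine h1.congr fun x hx => ?_
    have hxT : x ∈ T.baseSet := hTb ▸ hx.1
    simp only [hx, dite_true]
    have h2 := T.apply_mk_symm hxT (s i (φ x))
    rw [← T.symmL_apply (R := ℝ) hxT] at h2
    exact congrArg Prod.snd h2
  · intro x hx
    obtain ⟨τ, hτ'⟩ := hτ x hx.1
    have h1 := (hsU _ hx.2).2
    have h2 := h1.map' τ.toLinearMap (LinearEquiv.ker _)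
    refine LinearIndependent.of_comp (P.E x).subtype ?_
    convert h2 using 1
    · funext i
      simp only [Function.comp, hx, dite_true]
      exact (hτ' _).symm
    · rfl

variable (P)

open Classical in
/-- The smooth coordinate change between the trivializations dual to two local frames. -/
lemma exists_coordChange (e e' : P.Frame) : ∃ f : Y → (Fin r → ℝ) →L[ℝ] (Fin r → ℝ),
    ContMDiffOn 𝓘(ℝ, V) 𝓘(ℝ, (Fin r → ℝ) →L[ℝ] (Fin r → ℝ)) ∞ f (e.baseSet ∩ e'.baseSet) ∧
    ∀ b ∈ e.baseSet ∩ e'.baseSet, ∀ c, f b c = (e'.pretriv ⟨b, e.pretriv.symm b c⟩).2 := by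
  let a : Fin r → Fin r → Y → ℝ := fun j i x =>
    if hx : x ∈ e.baseSet then (e.basis x hx).repr (e'.vec j x) i else 0
  let L : Fin r → Fin r → ((Fin r → ℝ) →L[ℝ] (Fin r → ℝ)) := fun j i =>
    (ContinuousLinearMap.single ℝ (fun _ : Fin r => ℝ) j).comp (ContinuousLinearMap.proj i)
  refine ⟨fun x => ∑ j, ∑ i, a j i x • L j i, ?_, ?_⟩
  · rintro x ⟨hx, hx'⟩
    apply ContMDiffAt.contMDiffWithinAt
    refine contMDiffAt_finsetSum fun j _ => contMDiffAt_finsetSum fun i _ => ?_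
    have h : ContMDiffAt 𝓘(ℝ, V) 𝓘(ℝ, ℝ) ∞ (a j i) x :=
      e.contMDiffAt_repr e' j i x hx hx' _ fun y hy => dif_pos hy
    exact h.smul contMDiffAt_const
  · rintro x ⟨hx, hx'⟩ c
    rw [e'.pretriv_apply]
    ext k
    simp only [e.pretriv_symm_apply x hx, a, hx, dite_true, L]
    simp [Pi.single_apply]

/-- The dual bundle `E^*`, with the trivializations dual to the local frames of `E`. -/
def prebundle : VectorPrebundle ℝ (Fin r → ℝ) P.EDual where
  pretrivializationAtlas := range Frame.pretriv
  pretrivialization_linear' := by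
    rintro _ ⟨e, rfl⟩
    infer_instance
  pretrivializationAt x := (exists_frame (P := P) x).choose.pretriv
  mem_base_pretrivializationAt x := (exists_frame (P := P) x).choose_spec
  pretrivialization_mem_atlas x := mem_range_self _
  exists_coordChange := by
    rintro _ ⟨e, rfl⟩ _ ⟨e', rfl⟩
    obtain ⟨f, hf, h⟩ := P.exists_coordChange e e'
    exact ⟨f, hf.continuousOn, h⟩
  totalSpaceMk_isInducing x := by
    set e := (exists_frame (P := P) x).choose
    have hx : x ∈ e.baseSet := (exists_frame (P := P) x).choose_spec
    let φ : P.EDual x ≃L[ℝ] (Fin r → ℝ) := (e.pretriv.linearEquivAt ℝ x hx).toContinuousLinearEquiv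
    have : IsInducing fun α => (x, φ α) := isInducing_const_prod.mpr φ.toHomeomorph.isInducing
    exact this

instance : P.prebundle.IsContMDiff 𝓘(ℝ, V) ∞ where
  exists_contMDiffCoordChange := by
    rintro _ ⟨e, rfl⟩ _ ⟨e', rfl⟩
    exact P.exists_coordChange e e'

instance : TopologicalSpace (TotalSpace (Fin r → ℝ) P.EDual) := P.prebundle.totalSpaceTopology
instance : FiberBundle (Fin r → ℝ) P.EDual := P.prebundle.toFiberBundle
instance : VectorBundle ℝ (Fin r → ℝ) P.EDual := P.prebundle.toVectorBundle
instance : ContMDiffVectorBundle ∞ (Fin r → ℝ) P.EDual 𝓘(ℝ, V) :=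
  P.prebundle.contMDiffVectorBundle 𝓘(ℝ, V)

/-- The total space of `E^*`. It is a smooth manifold modelled on `V × ℝ ^ r`. -/
abbrev EStar : Type _ := TotalSpace (Fin r → ℝ) P.EDual

/-- The model with corners of the manifold `E^*`. -/
abbrev model (V : Type*) [NormedAddCommGroup V] [NormedSpace ℝ V] (r : ℕ) :
    ModelWithCorners ℝ (V × (Fin r → ℝ)) (ModelProd V (Fin r → ℝ)) :=
  (𝓘(ℝ, V)).prod 𝓘(ℝ, Fin r → ℝ)

/-- The bundle projection `E^* → Y`. -/
abbrev proj : P.EStar → Y := TotalSpace.proj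

/-- The zero section `Y → E^*`. -/
abbrev zero : Y → P.EStar := zeroSection (Fin r → ℝ) P.EDual

/-- A splitting `TY = G ⊕ E`, encoded by the smooth bundle map `Π : TY → TY` which is the
projection onto `E` along the complement `G = ker Π`. -/
structure Splitting where
  toProj : ∀ x : Y, TangentSpace 𝓘(ℝ, V) x →L[ℝ] TangentSpace 𝓘(ℝ, V) x
  idem : ∀ x v, toProj x (toProj x v) = toProj x v
  range_eq : ∀ x, LinearMap.range (toProj x).toLinearMap = P.E x
  smooth : ContMDiff 𝓘(ℝ, V) (𝓘(ℝ, V).prod 𝓘(ℝ, V →L[ℝ] V)) ∞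
    (fun x => TotalSpace.mk' (V →L[ℝ] V)
      (E := fun x : Y => TangentSpace 𝓘(ℝ, V) x →L[ℝ] TangentSpace 𝓘(ℝ, V) x) x (toProj x))

variable {P}

namespace Splitting

variable (S : P.Splitting)

/-- The projection `p_G : TY → E` along `G`. -/
def pG (x : Y) : TangentSpace 𝓘(ℝ, V) x →L[ℝ] P.E x :=
  (S.toProj x).codRestrict (P.E x) fun v => S.range_eq x ▸ LinearMap.mem_range_self _ v

/-- The `1`-form `θ_G` on `E^*`, given by `θ_G(v) = α (p_G (Tπ v))` for `v` tangent to `E^*`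
at `α`. -/
def theta : Form (model V r) P.EStar 1 := fun a =>
  ContinuousAlternatingMap.ofSubsingleton ℝ (TangentSpace (model V r) a) ℝ (0 : Fin 1)
    ((a.2 : P.E a.1 →L[ℝ] ℝ) ∘L S.pG a.1 ∘L mfderiv (model V r) 𝓘(ℝ, V) P.proj a)

/-- The closed `2`-form `ω_{E^*} = π^* ω - d θ_G` on `E^*`. -/
def omega : Form (model V r) P.EStar 2 := fun a =>
  (P.form a.1).compContinuousLinearMap (mfderiv (model V r) 𝓘(ℝ, V) P.proj a) -
    S.theta.d (model V r) a

/-- A symplectic thickening of `(Y, ω)`: an open neighbourhood `U` of the zero section of `E^*` on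
which `ω_{E^*}` is non-degenerate (endowed with the restriction `ω_U` of `ω_{E^*}`). -/
structure IsThickening (U : Set P.EStar) : Prop where
  isOpen : IsOpen U
  zero_mem : ∀ x : Y, P.zero x ∈ U
  nondegenerate : ∀ a ∈ U, S.omega.null (model V r) a = ⊥

end Splitting

end PresymplecticForm

section Hamiltonian

variable {E : Type*} [NormedAddCommGroup E] [NormedSpace ℝ E]
  {H : Type*} [TopologicalSpace H] (I : ModelWithCorners ℝ E H)
  {M : Type*} [TopologicalSpace M] [ChartedSpace H M] [IsManifold I 1 M]

/-- Smoothness of a vector field on an open set `U`. -/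
def SmoothOn (X : VField I M) (U : Set M) : Prop :=
  ContMDiffOn I I.tangent ∞ (fun x => (⟨x, X x⟩ : TangentBundle I M)) U

/-- The vector field `X` is locally (pre-)Hamiltonian on the open set `U` for the closed `2`-form
`η`: the `1`-form `X ⌟ η` is closed on `U`. -/
def IsLocallyHamiltonianOn (η : Form I M 2) (X : VField I M) (U : Set M) : Prop :=
  ∀ x ∈ U, (Form.interior I X η).d I x = 0

/-- The vector field `X` is (pre-)Hamiltonian on the open set `U` for the closed `2`-form `η`:
the `1`-form `X ⌟ η` is exact on `U`. -/
def IsHamiltonianOn (η : Form I M 2) (X : VField I M) (U : Set M) : Prop :=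
  ∃ f : M → ℝ, ContMDiffOn I 𝓘(ℝ, ℝ) ∞ f U ∧ ∀ x ∈ U, Form.interior I X η x = Form.dFun I f x

end Hamiltonian

/-- The vector field `Ξ` on (a neighbourhood of the zero section in) `E^*` extends the vector field
`ξ` on `Y`, where `Y` is identified with the zero section. -/
def Extends {V : Type*} [NormedAddCommGroup V] [NormedSpace ℝ V] [FiniteDimensional ℝ V]
    {Y : Type*} [TopologicalSpace Y] [ChartedSpace V Y] [IsManifold 𝓘(ℝ, V) ∞ Y] {r : ℕ}
    (P : PresymplecticForm V Y r) (Ξ : VField (PresymplecticForm.model V r) P.EStar)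
    (ξ : VField 𝓘(ℝ, V) Y) : Prop :=
  ∀ x : Y, Ξ (P.zero x) = mfderiv 𝓘(ℝ, V) (PresymplecticForm.model V r) P.zero x (ξ x)

end Presymplectic

end

/-! Let `F(α) = α(p_G ξ)`, a function on `E^*` that is linear on the fibres (`linearFun`).
Non-degeneracy of `ω_U` gives a unique vector field `Ξ` on `U` with `Ξ ⌟ ω_U = π^*(ξ ⌟ ω) + dF`
(`exists_interior_eq`). The right-hand side is closed as soon as `ξ ⌟ ω` is closed, and it equals
`d(f ∘ π + F)` when `ξ ⌟ ω = df`. The same `Ξ` therefore serves both halves of the theorem.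

It remains to see that `Ξ` restricts to `ξ` on the zero section. By non-degeneracy it is enough that
`To(ξ)` have the same contraction with `ω_{E^*}` at `0_x` as `Ξ` (`omega_zero`). The `π^*ω` part
contributes `π^*(ξ ⌟ ω)`, because `Tπ` sends `To(ξ)` to `ξ`. For the other part, write `θ_G = ∑ c_i
κ^i`, where the `c_i` are the values of `α` on a local frame of `E` and the `κ^i` are the components
of `p_G` in that frame. Where `c = 0` the derivatives of the `κ^i` drop out and `dθ_G = ∑ dc_i ∧
κ^i` (`d_theta_zero`). Since `To(ξ)` has no fibre component, its contraction with `-dθ_G` is `∑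
κ^i(ξ) dc_i`. This is also `dF` at `0_x`, by the same computation (`dFun_linearFun_zero`).

The remaining work is calculus in charts. Its main point is `Form.inChart_d`: the exterior
derivative, defined at each point in the chart centred there, may be computed in any preferred
chart. This makes `dθ_G`, and hence `ω_{E^*}` and `Ξ`, smooth. -/

namespace Presymplectic

/-! ### Differential forms and the exterior derivative in charts. -/

section Calculus

variable {E : Type*} [NormedAddCommGroup E] [NormedSpace ℝ E]
  {H : Type*} [TopologicalSpace H] {I : ModelWithCorners ℝ E H} [I.Boundaryless]
  {M : Type*} [TopologicalSpace M] [ChartedSpace H M] [IsManifold I ∞ M] {k : ℕ}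

omit [I.Boundaryless] [IsManifold I ∞ M] in
lemma Form.inChart_apply (η : Form I M k) (x₀ : M) (z : E) (v : Fin k → E) :
    η.inChart I x₀ z v = η ((extChartAt I x₀).symm z)
      (fun i => mfderivWithin 𝓘(ℝ, E) I (extChartAt I x₀).symm (range I) z (v i)) := rfl

omit [I.Boundaryless] in
lemma mfderiv_extChartAt_apply_symm (x₀ : M) {z : E} (hz : z ∈ (extChartAt I x₀).target) (v : E) :
    mfderiv I 𝓘(ℝ, E) (extChartAt I x₀) ((extChartAt I x₀).symm z)
      (mfderivWithin 𝓘(ℝ, E) I (extChartAt I x₀).symm (range I) z v) = v :=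
  congrArg (fun L : E →L[ℝ] E => L v)
    (mfderiv_extChartAt_comp_mfderivWithin_extChartAt_symm (I := I) hz)

omit [I.Boundaryless] in
lemma mfderivWithin_symm_apply_mfderiv (x₀ : M) {x : M} (hx : x ∈ (extChartAt I x₀).source)
    (v : TangentSpace I x) :
    mfderivWithin 𝓘(ℝ, E) I (extChartAt I x₀).symm (range I) (extChartAt I x₀ x)
      (mfderiv I 𝓘(ℝ, E) (extChartAt I x₀) x v) = v :=
  congrArg (fun L : E →L[ℝ] E => L v)
    (mfderivWithin_extChartAt_symm_comp_mfderiv_extChartAt' (I := I) hx)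

omit [I.Boundaryless] in
/-- A form at a point is determined by its local representative. -/
lemma Form.apply_eq_inChart (η : Form I M k) (x₀ : M) {x : M}
    (hx : x ∈ (extChartAt I x₀).source) (v : Fin k → TangentSpace I x) :
    η x v = η.inChart I x₀ (extChartAt I x₀ x)
      (fun i => mfderiv I 𝓘(ℝ, E) (extChartAt I x₀) x (v i)) := by
  -- The points `φ⁻¹(φ x)` and `x` are equal but not definitionally, so neither are the types of
  -- their tangent spaces. All of these unfold to `E`, and substituting a free point `y` carries out
  -- the transport. The same device recurs below.
  have key : ∀ y (_ : y = x) (w : Fin k → E), w = v →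
      η x v = (η y : E [⋀^Fin k]→L[ℝ] ℝ) w := by
    rintro y rfl w rfl; rfl
  exact key _ ((extChartAt I x₀).left_inv hx) _
    (funext fun i => mfderivWithin_symm_apply_mfderiv x₀ hx (v i))

omit [I.Boundaryless] [IsManifold I ∞ M] in
lemma Form.inChart_congr {η η' : Form I M k} (x₀ : M) {z : E}
    (h : η ((extChartAt I x₀).symm z) = η' ((extChartAt I x₀).symm z)) :
    η.inChart I x₀ z = η'.inChart I x₀ z := by
  unfold Form.inChart; rw [h]

omit [IsManifold I ∞ M] in
lemma extChartAt_target_mem_nhds_of_mem {x₀ : M} {z : E} (hz : z ∈ (extChartAt I x₀).target) :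
    (extChartAt I x₀).target ∈ 𝓝 z := (isOpen_extChartAt_target x₀).mem_nhds hz

omit [IsManifold I ∞ M] in
lemma continuousAt_extChartAt_symm_of_mem {x₀ : M} {z : E} (hz : z ∈ (extChartAt I x₀).target) :
    ContinuousAt (extChartAt I x₀).symm z :=
  (continuousOn_extChartAt_symm x₀).continuousAt (extChartAt_target_mem_nhds_of_mem hz)

lemma Form.d_apply (η : Form I M k) (x : M) (v : Fin (k + 1) → TangentSpace I x) :
    η.d I x v = extDeriv (η.inChart I x) (extChartAt I x x) v := by
  unfold Form.d
  rw [I.range_eq_univ, extDerivWithin_univ, mfderiv_extChartAt_self]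
  rfl

lemma Form.d_eq_zero {η : Form I M k} {x : M}
    (h : extDeriv (η.inChart I x) (extChartAt I x x) = 0) : η.d I x = 0 := by
  ext v
  refine (Form.d_apply η x v).trans ?_
  rw [h]
  rfl

lemma Form.extDeriv_inChart_eq_zero {η : Form I M k} {x : M} (h : η.d I x = 0) :
    extDeriv (η.inChart I x) (extChartAt I x x) = 0 := by
  ext v
  refine (Form.d_apply η x v).symm.trans ?_
  rw [h]
  rfl

/-- The local representative of the exterior derivative is the exterior derivative of the local
representative. -/
lemma Form.inChart_d {η : Form I M k} (hη : η.Smooth) (x₀ : M) {z : E}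
    (hz : z ∈ (extChartAt I x₀).target) :
    (η.d I).inChart I x₀ z = extDeriv (η.inChart I x₀) z := by
  set φ := extChartAt I x₀ with hφ
  set x := φ.symm z with hx
  set ψ := extChartAt I x with hψ
  have hxs : x ∈ φ.source := φ.map_target hz
  -- `Form.d` at `x` uses the chart `ψ` centred at `x`, not `φ`. The two are compared through the
  -- coordinate change `τ`, with which the exterior derivative commutes.
  let τ : E → E := ψ ∘ φ.symm
  have hsrc : ∀ᶠ w in 𝓝 z, w ∈ φ.target ∧ φ.symm w ∈ ψ.source :=
    (Filter.Eventually.and (extChartAt_target_mem_nhds_of_mem hz) <|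
      ((continuousAt_extChartAt_symm_of_mem hz).preimage_mem_nhds (extChartAt_source_mem_nhds x)))
  have hmd : ∀ w, w ∈ φ.target ∧ φ.symm w ∈ ψ.source → fderiv ℝ τ w =
      (mfderiv I 𝓘(ℝ, E) ψ (φ.symm w)).comp (mfderivWithin 𝓘(ℝ, E) I φ.symm (range I) w) := by
    rintro w ⟨hw, hw'⟩
    rw [← mfderiv_eq_fderiv, ← mfderivWithin_univ, ← I.range_eq_univ]
    refine mfderiv_comp_mfderivWithin w ?_ (mdifferentiableWithinAt_extChartAt_symm hw) ?_
    · exact mdifferentiableAt_extChartAt (by simpa [hψ] using hw')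
    · exact I.uniqueMDiffOn _ (extChartAt_target_subset_range x₀ hw)
  have hev : η.inChart I x₀ =ᶠ[𝓝 z]
      fun w => (η.inChart I x (τ w)).compContinuousLinearMap (fderiv ℝ τ w) := by
    filter_upwards [hsrc] with w hw
    ext v
    rw [Form.inChart_apply]
    refine (η.apply_eq_inChart x hw.2 _).trans ?_
    rw [hmd w hw]
    rfl
  have hτ : ContDiffAt ℝ ∞ τ z := by
    have h := contDiffWithinAt_ext_coord_change (I := I) (n := ∞) x x₀ (y := z)
      (by exact hsrc.self_of_nhds)
    rwa [I.range_eq_univ, contDiffWithinAt_univ] at h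
  have hd : DifferentiableAt ℝ (η.inChart I x) (τ z) :=
    ((hη x).contDiffAt (extChartAt_target_mem_nhds x)).differentiableAt (by simp)
  rw [hev.extDeriv_eq, extDeriv_pullback hd hτ (by simpa using ENat.LEInfty.out), hmd z hsrc.self_of_nhds]
  ext v
  refine (Form.d_apply η x _).trans ?_
  -- A chart has identity derivative at its own centre, so only the derivative of `φ⁻¹` survives.
  have h1 : mfderiv I 𝓘(ℝ, E) ψ (φ.symm z) = ContinuousLinearMap.id ℝ _ :=
    mfderiv_extChartAt_self (I := I) (x := x)
  rw [h1]
  rfl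

lemma Form.Smooth.d {η : Form I M k} (hη : η.Smooth) : (η.d I).Smooth := by
  intro x₀
  have h1 : ContDiffOn ℝ ∞ (fderiv ℝ (η.inChart I x₀)) (extChartAt I x₀).target :=
    (hη x₀).fderiv_of_isOpen (isOpen_extChartAt_target x₀) (by simp)
  have h2 := (ContinuousAlternatingMap.alternatizeUncurryFinCLM ℝ E ℝ
    (n := k)).contDiff.comp_contDiffOn h1
  exact h2.congr fun z hz => Form.inChart_d hη x₀ hz

/-- Locality of `d`: an identity between forms that holds only on the open set `U` can be
differentiated at the points of `U`. -/
lemma Form.d_congr {η η' : Form I M k} {x : M} (h : ∀ᶠ y in 𝓝 x, η y = η' y) :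
    η.d I x = η'.d I x := by
  have h1 : η.inChart I x =ᶠ[𝓝 (extChartAt I x x)] η'.inChart I x := by
    have hc := continuousAt_extChartAt_symm (I := I) x
    rw [ContinuousAt, extChartAt_to_inv] at hc
    filter_upwards [hc.eventually h] with z hz using Form.inChart_congr x hz
  ext v
  refine (Form.d_apply η x v).trans (Eq.trans ?_ (Form.d_apply η' x v).symm)
  rw [h1.extDeriv_eq]

omit [I.Boundaryless] [IsManifold I ∞ M] in
lemma Form.inChart_add (η η' : Form I M k) (x₀ : M) :
    (η + η').inChart I x₀ = η.inChart I x₀ + η'.inChart I x₀ := rfl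

omit [I.Boundaryless] [IsManifold I ∞ M] in
lemma Form.Smooth.add {η η' : Form I M k} (hη : η.Smooth) (hη' : η'.Smooth) :
    (η + η').Smooth := fun x₀ => (hη x₀).add (hη' x₀)

omit [I.Boundaryless] [IsManifold I ∞ M] in
lemma Form.Smooth.sub {η η' : Form I M k} (hη : η.Smooth) (hη' : η'.Smooth) :
    (η - η').Smooth := fun x₀ => (hη x₀).sub (hη' x₀)

omit [IsManifold I ∞ M] in
lemma Form.Smooth.differentiableAt {η : Form I M k} (hη : η.Smooth) (x₀ : M) {z : E}
    (hz : z ∈ (extChartAt I x₀).target) : DifferentiableAt ℝ (η.inChart I x₀) z :=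
  ((hη x₀).contDiffAt (extChartAt_target_mem_nhds_of_mem hz)).differentiableAt (by simp)

/-! ### Vector fields and contractions in charts. -/

/-- The local representative of a vector field in the preferred chart at `x₀`. -/
noncomputable def VField.inChart (X : VField I M) (x₀ : M) (z : E) : E :=
  mfderiv I 𝓘(ℝ, E) (extChartAt I x₀) ((extChartAt I x₀).symm z) (X ((extChartAt I x₀).symm z))

omit [I.Boundaryless] in
lemma mfderivWithin_symm_inChart (X : VField I M) (x₀ : M) {z : E}
    (hz : z ∈ (extChartAt I x₀).target) :
    mfderivWithin 𝓘(ℝ, E) I (extChartAt I x₀).symm (range I) z (X.inChart x₀ z) =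
      X ((extChartAt I x₀).symm z) :=
  congrArg (fun L : TangentSpace I ((extChartAt I x₀).symm z) →L[ℝ]
      TangentSpace I ((extChartAt I x₀).symm z) => L (X ((extChartAt I x₀).symm z)))
    (mfderivWithin_extChartAt_symm_comp_mfderiv_extChartAt (I := I) hz)

omit [I.Boundaryless] in
lemma Form.inChart_interior (η : Form I M (k + 1)) (X : VField I M) (x₀ : M) {z : E}
    (hz : z ∈ (extChartAt I x₀).target) :
    (Form.interior I X η).inChart I x₀ z = (η.inChart I x₀ z).curryLeft (X.inChart x₀ z) := by
  ext v
  refine congrArg (η ((extChartAt I x₀).symm z)) (funext fun i => ?_)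
  refine Fin.cases ?_ (fun j => ?_) i
  · exact (mfderivWithin_symm_inChart X x₀ hz).symm
  · rfl

-- Links smoothness of sections of the tangent bundle, which is tested in trivializations, with the
-- local representatives `VField.inChart`, which are defined by derivatives of charts.
omit [I.Boundaryless] in
lemma trivializationAt_snd_eq_mfderiv (x₀ : M) {x : M} (hx : x ∈ (extChartAt I x₀).source)
    (v : TangentSpace I x) :
    (trivializationAt E (TangentSpace I) x₀ ⟨x, v⟩).2 =
      mfderiv I 𝓘(ℝ, E) (extChartAt I x₀) x v := by
  have hx' : x ∈ (chartAt H x₀).source := by rwa [extChartAt_source] at hx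
  have h1 := TangentBundle.continuousLinearMapAt_trivializationAt (I := I) hx'
  have h2 : x ∈ (trivializationAt E (TangentSpace I) x₀).baseSet := by simpa using hx'
  have h3 := congrFun ((trivializationAt E (TangentSpace I) x₀).coe_linearMapAt_of_mem
    (R := ℝ) h2) v
  rw [← h3]
  exact congrArg (fun L : E →L[ℝ] E => L v) h1

omit [I.Boundaryless] in
lemma SmoothOn.contDiffOn_inChart {X : VField I M} {U : Set M} (hU : IsOpen U)
    (hX : SmoothOn I X U) (x₀ : M) :
    ContDiffOn ℝ ∞ (X.inChart x₀) ((extChartAt I x₀).target ∩ (extChartAt I x₀).symm ⁻¹' U) := by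
  let T := trivializationAt E (TangentSpace I : M → Type _) x₀
  have hT : T.baseSet = (extChartAt I x₀).source := by simp [T]
  have h1 := (T.contMDiffOn_section_iff (s := X) (hU.inter T.open_baseSet) inter_subset_right).1
    (hX.mono inter_subset_left)
  rw [← contMDiffOn_iff_contDiffOn]
  refine (h1.comp ((contMDiffOn_extChartAt_symm (n := ∞) x₀).mono inter_subset_left) ?_).congr ?_
  · rintro z ⟨hz, hz'⟩
    exact ⟨hz', hT ▸ (extChartAt I x₀).map_target hz⟩
  · rintro z ⟨hz, hz'⟩
    exact (trivializationAt_snd_eq_mfderiv x₀ ((extChartAt I x₀).map_target hz) _).symm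

-- Smoothness at `x` may be tested in the trivialization at `x`, so each chart has to be examined
-- only at its centre.
omit [I.Boundaryless] in
lemma smoothOn_of_contDiffAt_inChart {X : VField I M} {U : Set M}
    (h : ∀ x ∈ U, ContDiffAt ℝ ∞ (X.inChart x) (extChartAt I x x)) : SmoothOn I X U := by
  intro x₀ hx₀
  apply ContMDiffAt.contMDiffWithinAt
  let T := trivializationAt E (TangentSpace I : M → Type _) x₀
  refine (T.contMDiffAt_section_iff (s := X) (mem_baseSet_trivializationAt E _ x₀)).2 ?_
  refine ((h x₀ hx₀).contMDiffAt.comp x₀ contMDiffAt_extChartAt).congr_of_eventuallyEq ?_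
  filter_upwards [extChartAt_source_mem_nhds (I := I) x₀] with x hx
  refine (trivializationAt_snd_eq_mfderiv x₀ hx _).trans ?_
  have key : ∀ y (_ : y = x), (mfderiv I 𝓘(ℝ, E) (extChartAt I x₀) x (X x) : E) =
      mfderiv I 𝓘(ℝ, E) (extChartAt I x₀) y (X y) := by
    rintro y rfl; rfl
  exact key _ ((extChartAt I x₀).left_inv hx)

omit [I.Boundaryless] in
lemma Form.Smooth.interior {η : Form I M (k + 1)} (hη : η.Smooth) {X : VField I M}
    (hX : SmoothOn I X univ) : (Form.interior I X η).Smooth := by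
  intro x₀
  have h1 := hX.contDiffOn_inChart isOpen_univ x₀
  rw [preimage_univ, inter_univ] at h1
  have h2 : ContDiff ℝ ∞ (fun B : E [⋀^Fin (k + 1)]→L[ℝ] ℝ => B.curryLeft) :=
    LinearIsometry.contDiff (𝕜 := ℝ) (E := E [⋀^Fin (k + 1)]→L[ℝ] ℝ)
      (F := E →L[ℝ] E [⋀^Fin k]→L[ℝ] ℝ) ContinuousAlternatingMap.curryLeftLI
  exact ((h2.comp_contDiffOn (hη x₀)).clm_apply h1).congr
    fun z hz => η.inChart_interior X x₀ hz

/-! ### Differentials of functions. -/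

omit [I.Boundaryless] in
lemma Form.inChart_dFun_apply {f : M → ℝ} (x₀ : M) {z : E} [I.Boundaryless]
    (hz : z ∈ (extChartAt I x₀).target)
    (hf : MDifferentiableAt I 𝓘(ℝ, ℝ) f ((extChartAt I x₀).symm z)) :
    (Form.dFun I f).inChart I x₀ z =
      ContinuousAlternatingMap.ofSubsingleton ℝ E ℝ (0 : Fin 1)
        (fderiv ℝ (f ∘ (extChartAt I x₀).symm) z) := by
  have h : fderiv ℝ (f ∘ (extChartAt I x₀).symm) z =
      (mfderiv I 𝓘(ℝ, ℝ) f ((extChartAt I x₀).symm z)).comp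
        (mfderivWithin 𝓘(ℝ, E) I (extChartAt I x₀).symm (range I) z) := by
    rw [← mfderiv_eq_fderiv, ← mfderivWithin_univ, ← I.range_eq_univ]
    exact mfderiv_comp_mfderivWithin z hf (mdifferentiableWithinAt_extChartAt_symm hz)
      (I.uniqueMDiffOn _ (extChartAt_target_subset_range x₀ hz))
  rw [h]
  rfl

omit [I.Boundaryless] in
lemma contDiffOn_comp_extChartAt_symm {f : M → ℝ} (hf : ContMDiff I 𝓘(ℝ, ℝ) ∞ f) (x₀ : M) :
    ContDiffOn ℝ ∞ (f ∘ (extChartAt I x₀).symm) (extChartAt I x₀).target :=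
  contMDiffOn_iff_contDiffOn.1 (hf.comp_contMDiffOn (contMDiffOn_extChartAt_symm x₀))

/-- Presents `df` as the exterior derivative of a `0`-form, so that closedness of `df` becomes an
instance of `d ∘ d = 0`. -/
lemma Form.inChart_dFun {f : M → ℝ} (hf : ContMDiff I 𝓘(ℝ, ℝ) ∞ f) (x₀ : M) {z : E}
    (hz : z ∈ (extChartAt I x₀).target) :
    (Form.dFun I f).inChart I x₀ z =
      extDeriv (fun z => ContinuousAlternatingMap.constOfIsEmpty ℝ E (Fin 0)
        ((f ∘ (extChartAt I x₀).symm) z)) z := by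
  rw [extDeriv_constOfIsEmpty,
    Form.inChart_dFun_apply x₀ hz (hf.mdifferentiable (by simp) _)]

lemma Form.smooth_dFun {f : M → ℝ} (hf : ContMDiff I 𝓘(ℝ, ℝ) ∞ f) : (Form.dFun I f).Smooth := by
  intro x₀
  have h1 : ContDiffOn ℝ ∞ (fderiv ℝ (f ∘ (extChartAt I x₀).symm)) (extChartAt I x₀).target :=
    (contDiffOn_comp_extChartAt_symm hf x₀).fderiv_of_isOpen (isOpen_extChartAt_target x₀) (by simp)
  have h2 := (ContinuousAlternatingMap.ofSubsingletonLIE (𝕜 := ℝ) (E := E) (F := ℝ)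
      (0 : Fin 1)).contDiff.comp_contDiffOn h1
  exact h2.congr fun z hz => Form.inChart_dFun_apply x₀ hz (hf.mdifferentiable (by simp) _)

lemma Form.d_dFun {f : M → ℝ} (hf : ContMDiff I 𝓘(ℝ, ℝ) ∞ f) (x : M) :
    (Form.dFun I f).d I x = 0 := by
  apply Form.d_eq_zero
  have h1 : (Form.dFun I f).inChart I x =ᶠ[𝓝 (extChartAt I x x)]
      extDeriv (fun z => ContinuousAlternatingMap.constOfIsEmpty ℝ E (Fin 0)
        ((f ∘ (extChartAt I x).symm) z)) := by
    filter_upwards [extChartAt_target_mem_nhds (I := I) x] with z hz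
      using Form.inChart_dFun hf x hz
  have h2 : ContDiffAt ℝ ∞ (f ∘ (extChartAt I x).symm) (extChartAt I x x) :=
    (contDiffOn_comp_extChartAt_symm hf x).contDiffAt (extChartAt_target_mem_nhds x)
  rw [h1.extDeriv_eq]
  refine extDeriv_extDeriv_apply (r := ∞) ?_ (by simpa using ENat.LEInfty.out)
  exact (ContinuousAlternatingMap.constOfIsEmptyLIE ℝ E ℝ (Fin 0)).contDiff.contDiffAt.comp _ h2

lemma Form.d_add {η η' : Form I M k} (hη : η.Smooth) (hη' : η'.Smooth) (x : M) :
    (η + η').d I x = η.d I x + η'.d I x := by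
  ext v
  refine (Form.d_apply _ x v).trans ?_
  rw [Form.inChart_add, extDeriv_add (hη.differentiableAt x (mem_extChartAt_target x))
    (hη'.differentiableAt x (mem_extChartAt_target x))]
  exact (congrArg₂ (· + ·) (Form.d_apply η x v) (Form.d_apply η' x v)).symm

/-! ### Non-degenerate `2`-forms and the vector fields they define. -/

open PresymplecticForm in
/-- A nondegenerate `2`-form on a finite-dimensional space identifies this space with its dual. -/
lemma isInvertible_bilin [FiniteDimensional ℝ E] (B : E [⋀^Fin 2]→L[ℝ] ℝ)
    (hB : ∀ v, (∀ w, B ![v, w] = 0) → v = 0) : (Form.bilin B).IsInvertible := by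
  have : CompleteSpace E := FiniteDimensional.complete ℝ E
  have hinj : Function.Injective (Form.bilin B : E →ₗ[ℝ] E →L[ℝ] ℝ) := by
    refine (injective_iff_map_eq_zero _).2 fun v hv => hB v fun w => ?_
    rw [← Form.bilin_apply]
    exact congrArg (fun f : E →L[ℝ] ℝ => f w) hv
  have hd : Module.finrank ℝ E = Module.finrank ℝ (E →L[ℝ] ℝ) := by
    rw [← LinearMap.toContinuousLinearMap.finrank_eq (R := ℝ) (M := E →ₗ[ℝ] ℝ)]
    exact (Subspace.dual_finrank_eq).symm
  exact ⟨(LinearEquiv.ofInjectiveOfFinrankEq _ hinj hd).toContinuousLinearEquiv, by ext; rfl⟩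

/-- A `1`-form as a linear functional. -/
noncomputable def Form.functional : (E [⋀^Fin 1]→L[ℝ] ℝ) →L[ℝ] (E →L[ℝ] ℝ) :=
  (ContinuousAlternatingMap.ofSubsingletonLIE (𝕜 := ℝ) (E := E) (F := ℝ) (0 : Fin 1)).symm

lemma Form.functional_apply (b : E [⋀^Fin 1]→L[ℝ] ℝ) (v : E) :
    Form.functional b v = b ![v] := by
  have h : (fun _ : Fin 1 => v) = ![v] := by ext i; simp
  change b (fun _ : Fin 1 => v) = _
  rw [h]

-- The derivative of a chart is an isomorphism, so it carries null vectors of the representative to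
-- null vectors of the form.
omit [I.Boundaryless] in
lemma Form.inChart_nondegenerate {η : Form I M 2} (x₀ : M) {z : E}
    (hz : z ∈ (extChartAt I x₀).target)
    (hη : η.null I ((extChartAt I x₀).symm z) = ⊥) (v : E)
    (hv : ∀ w, η.inChart I x₀ z ![v, w] = 0) : v = 0 := by
  let L : E →L[ℝ] TangentSpace I ((extChartAt I x₀).symm z) :=
    mfderivWithin 𝓘(ℝ, E) I (extChartAt I x₀).symm (range I) z
  have h1 : L v ∈ η.null I ((extChartAt I x₀).symm z) := by
    intro w
    have h2 := hv (mfderiv I 𝓘(ℝ, E) (extChartAt I x₀) ((extChartAt I x₀).symm z) w)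
    rw [← h2]
    refine congrArg (η ((extChartAt I x₀).symm z)) (funext fun i => ?_)
    fin_cases i
    · rfl
    · exact (congrArg (fun L : TangentSpace I ((extChartAt I x₀).symm z) →L[ℝ]
        TangentSpace I ((extChartAt I x₀).symm z) => L w)
        (mfderivWithin_extChartAt_symm_comp_mfderiv_extChartAt (I := I) hz)).symm
  rw [hη, Submodule.mem_bot] at h1
  have h3 := mfderiv_extChartAt_apply_symm (I := I) x₀ hz v
  rw [← h3]
  change mfderiv I 𝓘(ℝ, E) (extChartAt I x₀) ((extChartAt I x₀).symm z) (L v) = 0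
  rw [h1, map_zero]

open PresymplecticForm in
/-- A `1`-form is the contraction of a nondegenerate `2`-form with a smooth vector field. -/
theorem exists_interior_eq [FiniteDimensional ℝ E] {η : Form I M 2} (hη : η.Smooth)
    {β : Form I M 1} (hβ : β.Smooth) {U : Set M} (hU : IsOpen U)
    (hnd : ∀ x ∈ U, η.null I x = ⊥) :
    ∃ X : VField I M, SmoothOn I X U ∧ ∀ x ∈ U, Form.interior I X η x = β x := by
  have hCS : CompleteSpace E := FiniteDimensional.complete ℝ E
  -- The inverse of a non-invertible map is `0` by convention, so `X` is defined on all of `M`. Only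
  -- its values on `U` matter.
  let X : VField I M := fun x => (Form.bilin (E := E) (η x)).inverse (Form.functional (E := E) (β x))
  have hX : ∀ x ∈ U, Form.interior I X η x = β x := by
    intro x hx
    have h1 : (Form.bilin (E := E) (η x)).IsInvertible := by
      refine isInvertible_bilin _ fun v hv => ?_
      have h2 : (v : TangentSpace I x) ∈ η.null I x := hv
      rwa [hnd x hx] at h2
    have h2 : Form.bilin (E := E) (η x) (X x) = Form.functional (E := E) (β x) :=
      h1.self_apply_inverse _
    ext v
    have h3 := congrArg (fun f : E →L[ℝ] ℝ => f (v 0)) h2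
    have h4 : v = ![v 0] := by ext i; fin_cases i; rfl
    rw [h4]
    exact (Form.bilin_apply (E := E) (η x) (X x) (v 0)).symm.trans
      (h3.trans (Form.functional_apply (E := E) (β x) (v 0)))
  refine ⟨X, smoothOn_of_contDiffAt_inChart fun x₀ hx₀ => ?_, hX⟩
  have hev : ∀ᶠ z in 𝓝 (extChartAt I x₀ x₀), z ∈ (extChartAt I x₀).target ∧
      (extChartAt I x₀).symm z ∈ U := by
    have hc := continuousAt_extChartAt_symm (I := I) x₀
    rw [ContinuousAt, extChartAt_to_inv] at hc
    exact Filter.Eventually.and (extChartAt_target_mem_nhds x₀) (hc.eventually (hU.mem_nhds hx₀))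
  have hinv : ∀ z, z ∈ (extChartAt I x₀).target ∧ (extChartAt I x₀).symm z ∈ U →
      (Form.bilin (η.inChart I x₀ z)).IsInvertible := fun z hz =>
    isInvertible_bilin _ (Form.inChart_nondegenerate x₀ hz.1 (hnd _ hz.2))
  -- Inversion is smooth at invertible maps, so the same formula applied to the local
  -- representatives is smooth. The contraction equation, read in the chart, then identifies it with
  -- the representative of `X`.
  have hsm : ContDiffAt ℝ ∞ (fun z => (Form.bilin (η.inChart I x₀ z)).inverse
      (Form.functional (β.inChart I x₀ z))) (extChartAt I x₀ x₀) := by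
    have h1 := (Form.contDiffOn_bilin (hη x₀)).contDiffAt (extChartAt_target_mem_nhds x₀)
    have h2 := ((hβ x₀).contDiffAt (extChartAt_target_mem_nhds x₀))
    have h3 := (hinv _ hev.self_of_nhds).contDiffAt_map_inverse.comp (extChartAt I x₀ x₀) h1
    have h4 : ContDiffAt ℝ ∞ (fun z => Form.functional (β.inChart I x₀ z)) (extChartAt I x₀ x₀) :=
      (Form.functional (E := E)).contDiff.contDiffAt.comp (extChartAt I x₀ x₀) h2
    exact h3.clm_apply h4
  refine hsm.congr_of_eventuallyEq ?_
  filter_upwards [hev] with z hz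
  have h1 : Form.bilin (η.inChart I x₀ z) (X.inChart x₀ z) =
      Form.functional (β.inChart I x₀ z) := by
    rw [← Form.inChart_congr x₀ (hX _ hz.2), Form.inChart_interior η X x₀ hz.1]
    rfl
  rw [← h1, (hinv z hz).inverse_apply_self]

end Calculus

/-! ### The preferred charts of `E^*`. -/

namespace PresymplecticForm

variable {V : Type*} [NormedAddCommGroup V] [NormedSpace ℝ V] [FiniteDimensional ℝ V]
  {Y : Type*} [TopologicalSpace Y] [ChartedSpace V Y] [IsManifold 𝓘(ℝ, V) ∞ Y] {r : ℕ}
  {P : PresymplecticForm V Y r}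

/-- The local frame of `E` at `x` which defines the preferred chart of `E^*` there. -/
noncomputable def frameAt (P : PresymplecticForm V Y r) (x : Y) : P.Frame := (exists_frame (P := P) x).choose

lemma mem_frameAt (x : Y) : x ∈ (P.frameAt x).baseSet := (exists_frame (P := P) x).choose_spec

/-- The trivialization of `E^*` at `a.1` is by construction the one dual to `frameAt`. Hence `z.1`
is the base coordinate and `z.2` records the values of the functional on that frame; all later
coordinate computations rest on this. -/
lemma extChartAt_apply (a b : P.EStar) :
    extChartAt (model V r) a b =
      (extChartAt 𝓘(ℝ, V) a.1 b.1, fun i => b.2 ((P.frameAt a.1).vec i b.1)) := by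
  rw [FiberBundle.extChartAt]
  rfl

lemma extChartAt_target_eq (a : P.EStar) : (extChartAt (model V r) a).target =
    ((extChartAt 𝓘(ℝ, V) a.1).target ∩
      (extChartAt 𝓘(ℝ, V) a.1).symm ⁻¹' (P.frameAt a.1).baseSet) ×ˢ univ :=
  FiberBundle.extChartAt_target a

lemma extChartAt_source_eq (a : P.EStar) : (extChartAt (model V r) a).source =
    P.proj ⁻¹' ((extChartAt 𝓘(ℝ, V) a.1).source ∩ (P.frameAt a.1).baseSet) := by
  rw [FiberBundle.extChartAt]
  ext b
  exact ⟨fun h => ⟨h.2.1, h.1⟩, fun h => ⟨h.2, h.1, trivial⟩⟩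

lemma proj_extChartAt_symm (a : P.EStar) {z : V × (Fin r → ℝ)}
    (hz : z ∈ (extChartAt (model V r) a).target) :
    ((extChartAt (model V r) a).symm z).1 = (extChartAt 𝓘(ℝ, V) a.1).symm z.1 := by
  have h1 := (extChartAt (model V r) a).right_inv hz
  have h2 := (extChartAt (model V r) a).map_target hz
  rw [extChartAt_source_eq] at h2
  rw [extChartAt_apply] at h1
  rw [← congrArg Prod.fst h1]
  exact ((extChartAt 𝓘(ℝ, V) a.1).left_inv h2.1).symm

lemma snd_extChartAt_symm (a : P.EStar) {z : V × (Fin r → ℝ)}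
    (hz : z ∈ (extChartAt (model V r) a).target) (i : Fin r) :
    ((extChartAt (model V r) a).symm z).2
      ((P.frameAt a.1).vec i ((extChartAt (model V r) a).symm z).1) = z.2 i := by
  have h1 := (extChartAt (model V r) a).right_inv hz
  rw [extChartAt_apply] at h1
  exact congrFun (congrArg Prod.snd h1) i

lemma fst_mem_target (a : P.EStar) {z : V × (Fin r → ℝ)}
    (hz : z ∈ (extChartAt (model V r) a).target) : z.1 ∈ (extChartAt 𝓘(ℝ, V) a.1).target := by
  rw [extChartAt_target_eq] at hz
  exact hz.1.1

lemma proj_mem_frameAt (a : P.EStar) {z : V × (Fin r → ℝ)}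
    (hz : z ∈ (extChartAt (model V r) a).target) :
    ((extChartAt (model V r) a).symm z).1 ∈ (P.frameAt a.1).baseSet := by
  have h2 := (extChartAt (model V r) a).map_target hz
  rw [extChartAt_source_eq] at h2
  exact h2.2

lemma contMDiff_proj : ContMDiff (model V r) 𝓘(ℝ, V) ∞ P.proj := fun _ =>
  Bundle.contMDiffAt_proj P.EDual

/-- Chain rule on both sides of the identity `π ∘ φ_a⁻¹ = φ⁻¹ ∘ fst`, which holds near `z`. -/
lemma mfderiv_proj_symm (a : P.EStar) {z : V × (Fin r → ℝ)}
    (hz : z ∈ (extChartAt (model V r) a).target) (w : V × (Fin r → ℝ)) :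
    (mfderiv (model V r) 𝓘(ℝ, V) P.proj ((extChartAt (model V r) a).symm z)
      (mfderivWithin 𝓘(ℝ, V × (Fin r → ℝ)) (model V r) (extChartAt (model V r) a).symm
        (range (model V r)) z w) : V) =
      mfderivWithin 𝓘(ℝ, V) 𝓘(ℝ, V) (extChartAt 𝓘(ℝ, V) a.1).symm (range 𝓘(ℝ, V)) z.1 w.1 := by
  have hz1 := fst_mem_target a hz
  have hu : UniqueMDiffWithinAt 𝓘(ℝ, V × (Fin r → ℝ)) (range (model V r)) z := by
    rw [(model V r).range_eq_univ]
    exact uniqueMDiffWithinAt_univ _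
  have h1 := mfderiv_comp_mfderivWithin z
    ((contMDiff_proj (P := P)).mdifferentiable (by simp) ((extChartAt (model V r) a).symm z))
    (mdifferentiableWithinAt_extChartAt_symm hz) hu
  have h2 : MDifferentiableAt 𝓘(ℝ, V) 𝓘(ℝ, V) (extChartAt 𝓘(ℝ, V) a.1).symm z.1 := by
    have := mdifferentiableWithinAt_extChartAt_symm (I := 𝓘(ℝ, V)) hz1
    rwa [ModelWithCorners.range_eq_univ, mdifferentiableWithinAt_univ] at this
  have h3 := mfderiv_comp (I := 𝓘(ℝ, V × (Fin r → ℝ))) z (f := Prod.fst) h2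
    (ContinuousLinearMap.fst ℝ V (Fin r → ℝ)).differentiableAt.mdifferentiableAt
  have h4 : (P.proj ∘ (extChartAt (model V r) a).symm) =ᶠ[𝓝 z]
      ((extChartAt 𝓘(ℝ, V) a.1).symm ∘ Prod.fst) := by
    filter_upwards [extChartAt_target_mem_nhds_of_mem hz] with y hy
      using proj_extChartAt_symm a hy
  have h5 := h4.mfderiv_eq (I := 𝓘(ℝ, V × (Fin r → ℝ))) (I' := 𝓘(ℝ, V))
  have h6 : mfderiv 𝓘(ℝ, V × (Fin r → ℝ)) 𝓘(ℝ, V) (Prod.fst : V × (Fin r → ℝ) → V) z =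
      ContinuousLinearMap.fst ℝ V (Fin r → ℝ) := by
    rw [mfderiv_eq_fderiv]
    exact fderiv_fst
  rw [h6] at h3
  rw [(model V r).range_eq_univ, mfderivWithin_univ, mfderivWithin_univ] at h1
  have h7 := (h1.symm.trans h5).trans h3
  rw [(model V r).range_eq_univ, mfderivWithin_univ, ModelWithCorners.range_eq_univ,
    mfderivWithin_univ]
  exact congrArg (fun L : V × (Fin r → ℝ) →L[ℝ] V => L w) h7

/-- The tangent space at `a` is the model space through the chart at `a` itself. In that chart and
the one at `a.1`, the projection is `Prod.fst`. -/
lemma mfderiv_proj_apply (a : P.EStar) (w : V × (Fin r → ℝ)) :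
    (mfderiv (model V r) 𝓘(ℝ, V) P.proj a w : V) = w.1 := by
  have h1 : writtenInExtChartAt (model V r) 𝓘(ℝ, V) a P.proj =ᶠ[𝓝 (extChartAt (model V r) a a)]
      Prod.fst := by
    filter_upwards [extChartAt_target_mem_nhds (I := model V r) a] with z hz
    have h2 := proj_extChartAt_symm a hz
    change extChartAt 𝓘(ℝ, V) a.1 ((extChartAt (model V r) a).symm z).1 = z.1
    rw [h2, (extChartAt 𝓘(ℝ, V) a.1).right_inv (fst_mem_target a hz)]
  have h3 := ((contMDiff_proj (P := P)).mdifferentiable (by simp) a).mfderiv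
  rw [(model V r).range_eq_univ, fderivWithin_univ, h1.fderiv_eq, fderiv_fst] at h3
  exact congrArg (fun L : V × (Fin r → ℝ) →L[ℝ] V => L w) h3

/-- In the charts at `x` and `0_x` the zero section is `z ↦ (z, 0)`. -/
lemma mfderiv_zero_apply (x : Y) (v : V) :
    (mfderiv 𝓘(ℝ, V) (model V r) P.zero x v : V × (Fin r → ℝ)) = (v, 0) := by
  have h1 : writtenInExtChartAt 𝓘(ℝ, V) (model V r) x P.zero =ᶠ[𝓝 (extChartAt 𝓘(ℝ, V) x x)]
      fun z => (z, (0 : Fin r → ℝ)) := by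
    filter_upwards [extChartAt_target_mem_nhds (I := 𝓘(ℝ, V)) x] with z hz
    change extChartAt (model V r) (P.zero x) (P.zero ((extChartAt 𝓘(ℝ, V) x).symm z)) = (z, 0)
    rw [extChartAt_apply]
    exact Prod.ext ((extChartAt 𝓘(ℝ, V) x).right_inv hz) rfl
  have h3 := (((Bundle.contMDiff_zeroSection ℝ P.EDual (n := ∞) (IB := 𝓘(ℝ, V))
    (F := Fin r → ℝ))).mdifferentiable (by simp) x).mfderiv
  have h4 : HasFDerivAt (fun z : V => (z, (0 : Fin r → ℝ)))
      ((ContinuousLinearMap.id ℝ V).prod 0) (extChartAt 𝓘(ℝ, V) x x) :=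
    (hasFDerivAt_id _).prodMk (hasFDerivAt_const _ _)
  rw [ModelWithCorners.range_eq_univ, fderivWithin_univ, h1.fderiv_eq, h4.fderiv] at h3
  exact congrArg (fun L : V →L[ℝ] V × (Fin r → ℝ) => L v) h3

/-! ### Pullback of forms from `Y` to `E^*`. -/

variable (P) in
/-- The pullback of a form to `E^*`. -/
noncomputable def pullback {k : ℕ} (η : Form 𝓘(ℝ, V) Y k) : Form (model V r) P.EStar k := fun a =>
  (η a.1).compContinuousLinearMap (mfderiv (model V r) 𝓘(ℝ, V) P.proj a)

lemma inChart_pullback {k : ℕ} (η : Form 𝓘(ℝ, V) Y k) (a : P.EStar) {z : V × (Fin r → ℝ)}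
    (hz : z ∈ (extChartAt (model V r) a).target) :
    (P.pullback η).inChart (model V r) a z = (η.inChart 𝓘(ℝ, V) a.1 z.1).compContinuousLinearMap
      (ContinuousLinearMap.fst ℝ V (Fin r → ℝ)) := by
  ext w
  have key : ∀ (y y' : Y) (_ : y = y') (v v' : Fin k → V), v = v' →
      (η y : V [⋀^Fin k]→L[ℝ] ℝ) v = (η y' : V [⋀^Fin k]→L[ℝ] ℝ) v' := by
    rintro y _ rfl w _ rfl; rfl
  exact key _ _ (proj_extChartAt_symm a hz) _ _
    (funext fun i => mfderiv_proj_symm a hz (w i))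

lemma smooth_pullback {k : ℕ} {η : Form 𝓘(ℝ, V) Y k} (hη : η.Smooth) :
    (P.pullback η).Smooth := by
  intro a
  have h1 : ContDiffOn ℝ ∞ (fun z : V × (Fin r → ℝ) => η.inChart 𝓘(ℝ, V) a.1 z.1)
      (extChartAt (model V r) a).target :=
    (hη a.1).comp contDiff_fst.contDiffOn fun z hz => fst_mem_target a hz
  have h2 := (ContinuousAlternatingMap.compContinuousLinearMapCLM (𝕜 := ℝ) (F := ℝ) (ι := Fin k)
    (ContinuousLinearMap.fst ℝ V (Fin r → ℝ))).contDiff.comp_contDiffOn h1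
  exact h2.congr fun z hz => inChart_pullback η a hz

/-- Naturality of `d` under `π`, which is `Prod.fst` in the charts, in the one case needed: the
pullback of a form whose exterior derivative vanishes. -/
lemma d_pullback {k : ℕ} {η : Form 𝓘(ℝ, V) Y k} (hη : η.Smooth) (a : P.EStar)
    (h : η.d 𝓘(ℝ, V) a.1 = 0) : (P.pullback η).d (model V r) a = 0 := by
  apply Form.d_eq_zero
  have h1 : (P.pullback η).inChart (model V r) a =ᶠ[𝓝 (extChartAt (model V r) a a)]
      fun z => (η.inChart 𝓘(ℝ, V) a.1 z.1).compContinuousLinearMap (fderiv ℝ Prod.fst z) := by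
    filter_upwards [extChartAt_target_mem_nhds (I := model V r) a] with z hz
    rw [inChart_pullback η a hz, fderiv_fst]
  have h2 : (extChartAt (model V r) a a).1 = extChartAt 𝓘(ℝ, V) a.1 a.1 := by
    rw [extChartAt_apply]
  have h3 : DifferentiableAt ℝ (η.inChart 𝓘(ℝ, V) a.1) (extChartAt (model V r) a a).1 := by
    rw [h2]
    exact hη.differentiableAt _ (mem_extChartAt_target _)
  rw [h1.extDeriv_eq, extDeriv_pullback (r := ∞) h3 contDiffAt_fst
    (by simpa using ENat.LEInfty.out), h2, Form.extDeriv_inChart_eq_zero h]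
  rfl

/-! ### Smoothness of `p_G`, `θ_G`, `ω_{E^*}` and the fibrewise linear functions. -/

namespace Splitting

variable (S : P.Splitting)

open Classical in
/-- The coordinates of the projection of a tangent vector to `E`, with respect to a local frame. -/
noncomputable def coord (e : P.Frame) (x : Y) : TangentSpace 𝓘(ℝ, V) x →L[ℝ] (Fin r → ℝ) :=
  if h : x ∈ e.baseSet then
    LinearMap.toContinuousLinearMap ((e.basis x h).equivFun.toLinearMap ∘ₗ (S.pG x).toLinearMap)
  else 0

lemma sum_coord_smul (e : P.Frame) {x : Y} (hx : x ∈ e.baseSet) (v : TangentSpace 𝓘(ℝ, V) x) :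
    ∑ i, S.coord e x v i • e.vec i x = S.pG x v := by
  rw [← (e.basis x hx).sum_equivFun (S.pG x v)]
  refine Finset.sum_congr rfl fun i _ => ?_
  rw [coord, dif_pos hx, e.basis_apply]
  rfl

/-- The source of the coordinate formulas for both `θ_G` and `F`: each is a sum of fibre coordinates
times functions pulled back from the base. -/
lemma apply_pG (e : P.Frame) {x : Y} (hx : x ∈ e.baseSet) (α : P.EDual x)
    (v : TangentSpace 𝓘(ℝ, V) x) :
    (α : P.E x →L[ℝ] ℝ) (S.pG x v) = ∑ i, α (e.vec i x) * S.coord e x v i := by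
  rw [← S.sum_coord_smul e hx v, map_sum]
  refine Finset.sum_congr rfl fun i _ => ?_
  rw [map_smul, smul_eq_mul, mul_comm]

/-- The coordinates of the projection of a smooth vector field to `E` are smooth. -/
lemma contMDiffAt_coord (e : P.Frame) {X : VField 𝓘(ℝ, V) Y} {x₀ : Y} (hx₀ : x₀ ∈ e.baseSet)
    (hX : ContMDiffAt 𝓘(ℝ, V) 𝓘(ℝ, V).tangent ∞
      (fun x => (⟨x, X x⟩ : TangentBundle 𝓘(ℝ, V) Y)) x₀) :
    ContMDiffAt 𝓘(ℝ, V) 𝓘(ℝ, Fin r → ℝ) ∞ (fun x => S.coord e x (X x)) x₀ := by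
  let T := trivializationAt V (TangentSpace 𝓘(ℝ, V)) x₀
  let t : ∀ x : Y, TangentSpace 𝓘(ℝ, V) x →ₗ[ℝ] V := fun x => T.linearMapAt ℝ x
  have hT : x₀ ∈ T.baseSet := mem_baseSet_trivializationAt V _ x₀
  have hsm : ∀ (Z : VField 𝓘(ℝ, V) Y), ContMDiffAt 𝓘(ℝ, V) 𝓘(ℝ, V).tangent ∞
      (fun x => (⟨x, Z x⟩ : TangentBundle 𝓘(ℝ, V) Y)) x₀ →
      ContMDiffAt 𝓘(ℝ, V) 𝓘(ℝ, V) ∞ (fun x => t x (Z x)) x₀ := by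
    intro Z hZ
    refine ((T.contMDiffAt_section_iff hT).1 hZ).congr_of_eventuallyEq ?_
    filter_upwards [T.open_baseSet.mem_nhds hT] with x hx
    exact congrFun (T.coe_linearMapAt_of_mem hx) _
  have hse : ∀ k, ContMDiffAt 𝓘(ℝ, V) 𝓘(ℝ, V) ∞ (fun x => t x (e.vec k x)) x₀ := fun k =>
    hsm (fun x => e.vec k x) ((e.smooth k).contMDiffAt (e.isOpen_baseSet.mem_nhds hx₀))
  have hsX : ContMDiffAt 𝓘(ℝ, V) 𝓘(ℝ, V) ∞ (fun x => t x (S.toProj x (X x))) x₀ :=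
    hsm (fun x => S.toProj x (X x)) ((S.smooth x₀).clm_bundle_apply hX)
  have hli : LinearIndependent ℝ (fun k => t x₀ (e.vec k x₀)) := by
    have h1 : LinearIndependent ℝ (fun k => (e.vec k x₀ : TangentSpace 𝓘(ℝ, V) x₀)) :=
      (e.linearIndependent x₀ hx₀).map' (P.E x₀).subtype (Submodule.ker_subtype _)
    refine h1.map' (t x₀) ?_
    have h2 : t x₀ = (T.linearEquivAt ℝ x₀ hT : TangentSpace 𝓘(ℝ, V) x₀ →ₗ[ℝ] V) :=
      T.linearMapAt_def_of_mem hT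
    rw [h2]
    exact LinearEquiv.ker _
  let u : (Fin r → ℝ) →ₗ[ℝ] V := Fintype.linearCombination ℝ (fun k => t x₀ (e.vec k x₀))
  obtain ⟨L, hL⟩ := u.exists_leftInverse_of_injective
    (LinearMap.ker_eq_bot.2 (linearIndependent_iff_injective_fintypeLinearCombination.1 hli))
  -- `L'` is a left inverse of the frame at `x₀`, kept fixed as `x` varies. `N x` is `L'` composed
  -- with the frame at `x`: it is the identity at `x₀`, hence invertible nearby. Since `N x` sends
  -- the coordinates to `L'` of the projected vector, inverting it expresses them by smooth data.
  let L' : V →L[ℝ] (Fin r → ℝ) := LinearMap.toContinuousLinearMap L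
  let N : Y → (Fin r → ℝ) →L[ℝ] (Fin r → ℝ) := fun x =>
    ∑ k, (ContinuousLinearMap.proj k : (Fin r → ℝ) →L[ℝ] ℝ).smulRight (L' (t x (e.vec k x)))
  have hNa : ∀ x c, N x c = ∑ k, c k • L' (t x (e.vec k x)) := fun x c => by simp [N]
  have hN : ContMDiffAt 𝓘(ℝ, V) 𝓘(ℝ, (Fin r → ℝ) →L[ℝ] (Fin r → ℝ)) ∞ N x₀ := by
    refine contMDiffAt_finsetSum fun k _ => ?_
    have h1 : ContMDiffAt 𝓘(ℝ, V) 𝓘(ℝ, Fin r → ℝ) ∞ (fun x => L' (t x (e.vec k x))) x₀ :=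
      L'.contMDiff.contMDiffAt.comp x₀ (hse k)
    exact (ContinuousLinearMap.smulRightL ℝ (Fin r → ℝ) (Fin r → ℝ)
      (ContinuousLinearMap.proj k)).contMDiff.contMDiffAt.comp x₀ h1
  have hN0 : N x₀ = (ContinuousLinearEquiv.refl ℝ (Fin r → ℝ) :
      (Fin r → ℝ) →L[ℝ] (Fin r → ℝ)) := by
    ext1 c
    have h1 : L (u c) = c := LinearMap.congr_fun hL c
    rw [hNa]
    simpa [u, Fintype.linearCombination_apply, L'] using h1
  have hinv : ∀ᶠ x in 𝓝 x₀, (N x).IsInvertible := by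
    have h1 := (ContinuousLinearEquiv.refl ℝ (Fin r → ℝ)).nhds
    rw [← hN0] at h1
    exact hN.continuousAt h1
  have hfin : ContMDiffAt 𝓘(ℝ, V) 𝓘(ℝ, Fin r → ℝ) ∞
      (fun x => (N x).inverse (L' (t x (S.toProj x (X x))))) x₀ := by
    have h0 : (N x₀).IsInvertible := ⟨_, hN0.symm⟩
    have h1 := h0.contDiffAt_map_inverse (n := ∞).contMDiffAt.comp x₀ hN
    exact h1.clm_apply (L'.contMDiff.contMDiffAt.comp x₀ hsX)
  refine hfin.congr_of_eventuallyEq ?_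
  filter_upwards [hinv, e.isOpen_baseSet.mem_nhds hx₀] with x hx hxe
  have h1 : N x (S.coord e x (X x)) = L' (t x (S.toProj x (X x))) := by
    have h2 := congrArg (fun v : P.E x => L' (t x v)) (S.sum_coord_smul e hxe (X x))
    have h3 : ((S.pG x (X x) : P.E x) : TangentSpace 𝓘(ℝ, V) x) = S.toProj x (X x) := rfl
    rw [hNa, ← h3, ← h2]
    simp
  rw [← h1, hx.inverse_apply_self]

/-- The coordinates of the projection to `E`, in the preferred chart at `x₀` and the preferred
local frame at `x₀`. -/
noncomputable def coordInChart (x₀ : Y) (z : V) : V →L[ℝ] (Fin r → ℝ) :=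
  (S.coord (P.frameAt x₀) ((extChartAt 𝓘(ℝ, V) x₀).symm z)).comp
    (mfderivWithin 𝓘(ℝ, V) 𝓘(ℝ, V) (extChartAt 𝓘(ℝ, V) x₀).symm (range 𝓘(ℝ, V)) z)

lemma contDiffOn_coord {X : VField 𝓘(ℝ, V) Y} (x₀ : Y)
    (hX : SmoothOn 𝓘(ℝ, V) X (extChartAt 𝓘(ℝ, V) x₀).source) :
    ContDiffOn ℝ ∞ (fun z => S.coord (P.frameAt x₀) ((extChartAt 𝓘(ℝ, V) x₀).symm z)
        (X ((extChartAt 𝓘(ℝ, V) x₀).symm z)))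
      ((extChartAt 𝓘(ℝ, V) x₀).target ∩
        (extChartAt 𝓘(ℝ, V) x₀).symm ⁻¹' (P.frameAt x₀).baseSet) := by
  rw [← contMDiffOn_iff_contDiffOn]
  rintro z ⟨hz, hz'⟩
  have h1 := S.contMDiffAt_coord (P.frameAt x₀) hz' (X := X)
    (hX.contMDiffAt ((isOpen_extChartAt_source x₀).mem_nhds ((extChartAt 𝓘(ℝ, V) x₀).map_target hz)))
  exact h1.comp_contMDiffWithinAt z
    ((contMDiffOn_extChartAt_symm (n := ∞) x₀).mono inter_subset_left z ⟨hz, hz'⟩)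

lemma contDiffOn_coordInChart (x₀ : Y) :
    ContDiffOn ℝ ∞ (S.coordInChart x₀) ((extChartAt 𝓘(ℝ, V) x₀).target ∩
        (extChartAt 𝓘(ℝ, V) x₀).symm ⁻¹' (P.frameAt x₀).baseSet) := by
  refine contDiffOn_clm_apply.2 fun v => ?_
  let T := trivializationAt V (TangentSpace 𝓘(ℝ, V)) x₀
  have hT : T.baseSet = (extChartAt 𝓘(ℝ, V) x₀).source := by simp [T]
  -- The vector field with constant representative `v` in the chart; smoothness of the family of
  -- linear maps is tested on these fields.
  have h1 : SmoothOn 𝓘(ℝ, V) (fun x => T.symmL ℝ x v) (extChartAt 𝓘(ℝ, V) x₀).source := by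
    refine (T.contMDiffOn_section_iff (isOpen_extChartAt_source x₀) hT.ge).2 ?_
    refine (contMDiffOn_const (c := v)).congr fun x hx => ?_
    have hxT : x ∈ T.baseSet := hT ▸ hx
    have h2 := T.apply_mk_symm hxT v
    rw [← T.symmL_apply (R := ℝ) hxT] at h2
    exact congrArg Prod.snd h2
  refine (S.contDiffOn_coord x₀ h1).congr fun z hz => ?_
  have hx : (extChartAt 𝓘(ℝ, V) x₀).symm z ∈ (chartAt V x₀).source := by
    simpa using (extChartAt 𝓘(ℝ, V) x₀).map_target hz.1
  have h3 := TangentBundle.symmL_trivializationAt (I := 𝓘(ℝ, V)) hx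
  rw [(extChartAt 𝓘(ℝ, V) x₀).right_inv hz.1] at h3
  change S.coord (P.frameAt x₀) _ (_ : TangentSpace 𝓘(ℝ, V) ((extChartAt 𝓘(ℝ, V) x₀).symm z)) = _
  exact congrArg (S.coord (P.frameAt x₀) ((extChartAt 𝓘(ℝ, V) x₀).symm z))
    (congrArg (fun L : V →L[ℝ] V => L v) h3.symm)

/-- The function on `E^*` which is linear on the fibres and given by the projection of a vector
field to `E`. -/
noncomputable def linearFun (X : VField 𝓘(ℝ, V) Y) (a : P.EStar) : ℝ :=
  (a.2 : P.E a.1 →L[ℝ] ℝ) (S.pG a.1 (X a.1))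

lemma linearFun_symm (X : VField 𝓘(ℝ, V) Y) (a : P.EStar) {z : V × (Fin r → ℝ)}
    (hz : z ∈ (extChartAt (model V r) a).target) :
    S.linearFun X ((extChartAt (model V r) a).symm z) =
      ∑ i, z.2 i * S.coord (P.frameAt a.1) ((extChartAt 𝓘(ℝ, V) a.1).symm z.1)
        (X ((extChartAt 𝓘(ℝ, V) a.1).symm z.1)) i := by
  unfold linearFun
  rw [S.apply_pG _ (proj_mem_frameAt a hz)]
  simp_rw [snd_extChartAt_symm a hz]
  rw [proj_extChartAt_symm a hz]

lemma contMDiff_linearFun {X : VField 𝓘(ℝ, V) Y} (hX : SmoothOn 𝓘(ℝ, V) X univ) :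
    ContMDiff (model V r) 𝓘(ℝ, ℝ) ∞ (S.linearFun X) := by
  intro a
  have h0 : ContMDiffAt (model V r) 𝓘(ℝ, V × (Fin r → ℝ)) ∞ (extChartAt (model V r) a) a :=
    contMDiffAt_extChartAt
  have h1 : ContMDiffAt (model V r) 𝓘(ℝ, Fin r → ℝ) ∞
      (fun b => (extChartAt (model V r) a b).2) a :=
    contDiff_snd.contMDiff.contMDiffAt.comp a h0
  have h2 : ContMDiffAt (model V r) 𝓘(ℝ, Fin r → ℝ) ∞
      (fun b : P.EStar => S.coord (P.frameAt a.1) b.1 (X b.1)) a :=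
    (S.contMDiffAt_coord (P.frameAt a.1) (mem_frameAt a.1)
      (hX.contMDiffAt Filter.univ_mem)).comp a (contMDiff_proj a)
  have h3 : ContMDiffAt (model V r) 𝓘(ℝ, ℝ) ∞ (fun b : P.EStar =>
      ∑ i, (extChartAt (model V r) a b).2 i * S.coord (P.frameAt a.1) b.1 (X b.1) i) a := by
    refine contMDiffAt_finsetSum fun i _ => ?_
    exact (contMDiffAt_pi_space.1 h1 i).mul (contMDiffAt_pi_space.1 h2 i)
  refine h3.congr_of_eventuallyEq ?_
  filter_upwards [(contMDiff_proj (P := P)).continuous.continuousAt.preimage_mem_nhds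
    ((P.frameAt a.1).isOpen_baseSet.mem_nhds (mem_frameAt a.1))] with b hb
  rw [extChartAt_apply]
  exact S.apply_pG _ hb b.2 (X b.1)

/-- The value of `θ_G` in the preferred charts, as a linear functional. -/
lemma inChart_theta_apply (a : P.EStar) {z : V × (Fin r → ℝ)}
    (hz : z ∈ (extChartAt (model V r) a).target) (w : Fin 1 → V × (Fin r → ℝ)) :
    S.theta.inChart (model V r) a z w = ∑ i, z.2 i * S.coordInChart a.1 z.1 (w 0).1 i := by
  refine (S.apply_pG _ (proj_mem_frameAt a hz) _ _).trans ?_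
  refine Finset.sum_congr rfl fun i _ => ?_
  rw [snd_extChartAt_symm a hz]
  have key : ∀ (y y' : Y) (_ : y = y') (v v' : V), v = v' →
      S.coord (P.frameAt a.1) y v i = S.coord (P.frameAt a.1) y' v' i := by
    rintro y _ rfl w _ rfl; rfl
  exact congrArg (z.2 i * ·) (key _ _ (proj_extChartAt_symm a hz) _ _ (mfderiv_proj_symm a hz (w 0)))

lemma smooth_theta : S.theta.Smooth := by
  intro a
  have h0 : ContDiffOn ℝ ∞ (fun z : V × (Fin r → ℝ) => S.coordInChart a.1 z.1)
      (extChartAt (model V r) a).target := by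
    refine (S.contDiffOn_coordInChart a.1).comp contDiff_fst.contDiffOn fun z hz => ?_
    rw [extChartAt_target_eq] at hz
    exact hz.1
  have h1 : ContDiffOn ℝ ∞ (fun z : V × (Fin r → ℝ) => ∑ i, z.2 i •
      ((ContinuousLinearMap.proj (R := ℝ) (φ := fun _ : Fin r => ℝ) i).comp
        ((S.coordInChart a.1 z.1).comp (ContinuousLinearMap.fst ℝ V (Fin r → ℝ)))))
      (extChartAt (model V r) a).target := by
    refine ContDiffOn.sum fun i _ => ContDiffOn.fun_smul ?_ ?_
    · exact ((ContinuousLinearMap.proj (R := ℝ) (φ := fun _ : Fin r => ℝ) i).comp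
        (ContinuousLinearMap.snd ℝ V (Fin r → ℝ))).contDiff.contDiffOn
    · exact contDiffOn_const.clm_comp (h0.clm_comp contDiffOn_const)
  have h2 := (ContinuousAlternatingMap.ofSubsingletonLIE (𝕜 := ℝ) (E := V × (Fin r → ℝ)) (F := ℝ)
      (0 : Fin 1)).contDiff.comp_contDiffOn h1
  refine h2.congr fun z hz => ?_
  ext w
  rw [S.inChart_theta_apply a hz w]
  simp

lemma smooth_omega : S.omega.Smooth :=
  (smooth_pullback P.smooth).sub S.smooth_theta.d

end Splitting

/-! ### First-order behaviour along the zero section, and the extension. -/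

-- By the product rule, the derivative of `g` is multiplied by the fibre coordinate, which is `0`
-- here. Only the value of `g` enters, so no derivative of the splitting survives in `dθ_G` or `dF`
-- along the zero section.
omit [FiniteDimensional ℝ V] in
lemma hasFDerivAt_sum_snd_mul {g : V → Fin r → ℝ} {x : V} (hg : DifferentiableAt ℝ g x) :
    HasFDerivAt (fun z : V × (Fin r → ℝ) => ∑ i, z.2 i * g z.1 i)
      (∑ i, g x i • ((ContinuousLinearMap.proj (R := ℝ) (φ := fun _ : Fin r => ℝ) i).comp
        (ContinuousLinearMap.snd ℝ V (Fin r → ℝ)))) (x, 0) := by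
  refine HasFDerivAt.fun_sum fun i _ => ?_
  have h1 : HasFDerivAt (fun z : V × (Fin r → ℝ) => z.2 i)
      ((ContinuousLinearMap.proj (R := ℝ) (φ := fun _ : Fin r => ℝ) i).comp
        (ContinuousLinearMap.snd ℝ V (Fin r → ℝ))) (x, 0) :=
    ((ContinuousLinearMap.proj (R := ℝ) (φ := fun _ : Fin r => ℝ) i).comp
      (ContinuousLinearMap.snd ℝ V (Fin r → ℝ))).hasFDerivAt
  have h2 : DifferentiableAt ℝ (fun z : V × (Fin r → ℝ) => g z.1 i) (x, 0) := by
    have h3 : DifferentiableAt ℝ (fun z : V × (Fin r → ℝ) => g z.1) (x, 0) :=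
      DifferentiableAt.comp (x, 0) (g := g) (f := Prod.fst) hg differentiableAt_fst
    exact differentiableAt_pi.1 h3 i
  refine (h1.mul h2.hasFDerivAt).congr_fderiv ?_
  simp

omit [FiniteDimensional ℝ V] in
lemma fderiv_sum_snd_mul {g : V → Fin r → ℝ} {x : V} (hg : DifferentiableAt ℝ g x)
    (w : V × (Fin r → ℝ)) :
    fderiv ℝ (fun z : V × (Fin r → ℝ) => ∑ i, z.2 i * g z.1 i) (x, 0) w =
      ∑ i, w.2 i * g x i := by
  rw [(hasFDerivAt_sum_snd_mul hg).fderiv]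
  simp [mul_comm]

namespace Splitting

variable (S : P.Splitting)

lemma extChartAt_zero (x : Y) :
    extChartAt (model V r) (P.zero x) (P.zero x) = (extChartAt 𝓘(ℝ, V) x x, 0) := by
  rw [extChartAt_apply]
  rfl

lemma coordInChart_self (x : Y) (v : V) :
    S.coordInChart x (extChartAt 𝓘(ℝ, V) x x) v = S.coord (P.frameAt x) x v := by
  have key : ∀ (y : Y) (_ : y = x) (v' : V), v' = v →
      S.coord (P.frameAt x) y v' = S.coord (P.frameAt x) x v := by
    rintro y rfl w rfl; rfl
  refine key _ (extChartAt_to_inv x) _ ?_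
  exact congrArg (fun L : V →L[ℝ] V => L v)
    (mfderivWithin_range_extChartAt_symm (I := 𝓘(ℝ, V)) (x := x))

/-- The exterior derivative of `θ_G` along the zero section. -/
lemma d_theta_zero (x : Y) (v w : V × (Fin r → ℝ)) :
    S.theta.d (model V r) (P.zero x) ![v, w] =
      ∑ i, v.2 i * S.coord (P.frameAt x) x w.1 i - ∑ i, w.2 i * S.coord (P.frameAt x) x v.1 i := by
  refine (Form.d_apply _ _ _).trans ?_
  have hmem := extChartAt_target_mem_nhds (I := model V r) (P.zero x)
  have hdif := S.smooth_theta.differentiableAt (P.zero x) (mem_extChartAt_target (P.zero x))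
  have hC : ContDiffAt ℝ ∞ (S.coordInChart x) (extChartAt 𝓘(ℝ, V) x x) := by
    refine (S.contDiffOn_coordInChart x).contDiffAt ?_
    refine Filter.inter_mem (extChartAt_target_mem_nhds x)
      ((continuousAt_extChartAt_symm x).preimage_mem_nhds ?_)
    rw [extChartAt_to_inv]
    exact (P.frameAt x).isOpen_baseSet.mem_nhds (mem_frameAt x)
  have key : ∀ (u : Fin 1 → V × (Fin r → ℝ)) (u' : V × (Fin r → ℝ)),
      fderiv ℝ (fun z => S.theta.inChart (model V r) (P.zero x) z u)
        (extChartAt (model V r) (P.zero x) (P.zero x)) u' =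
      ∑ i, u'.2 i * S.coord (P.frameAt x) x (u 0).1 i := by
    intro u u'
    have h1 : (fun z => S.theta.inChart (model V r) (P.zero x) z u) =ᶠ[𝓝
        (extChartAt (model V r) (P.zero x) (P.zero x))]
        fun z => ∑ i, z.2 i * S.coordInChart x z.1 (u 0).1 i := by
      filter_upwards [hmem] with z hz using S.inChart_theta_apply (P.zero x) hz u
    rw [h1.fderiv_eq, extChartAt_zero, fderiv_sum_snd_mul
      (g := fun z => S.coordInChart x z (u 0).1)
      ((hC.differentiableAt (by simp)).clm_apply (differentiableAt_const _))]
    simp_rw [coordInChart_self]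
  -- On constant vectors, the exterior derivative of a `1`-form is the alternating sum of two
  -- directional derivatives, both given by `key`.
  refine (extDeriv_apply hdif _).trans ?_
  rw [Fin.sum_univ_two]
  refine (congrArg₂ (fun s t : ℝ => (-1) ^ (0 : ℕ) • s + (-1) ^ (1 : ℕ) • t)
    (key _ _) (key _ _)).trans ?_
  rw [pow_zero, one_smul, pow_one, neg_one_smul, ← sub_eq_add_neg]
  rfl

/-- The differential of a fibrewise linear function along the zero section. -/
lemma dFun_linearFun_zero {X : VField 𝓘(ℝ, V) Y} (hX : SmoothOn 𝓘(ℝ, V) X univ) (x : Y)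
    (w : V × (Fin r → ℝ)) :
    Form.dFun (model V r) (S.linearFun X) (P.zero x) ![w] =
      ∑ i, w.2 i * S.coord (P.frameAt x) x (X x) i := by
  have h1 := ((S.contMDiff_linearFun hX).mdifferentiable (by simp) (P.zero x)).mfderiv
  have h2 : writtenInExtChartAt (model V r) 𝓘(ℝ, ℝ) (P.zero x) (S.linearFun X) =ᶠ[𝓝
      (extChartAt (model V r) (P.zero x) (P.zero x))] fun z => ∑ i, z.2 i *
        S.coord (P.frameAt x) ((extChartAt 𝓘(ℝ, V) x).symm z.1)
        (X ((extChartAt 𝓘(ℝ, V) x).symm z.1)) i := by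
    filter_upwards [extChartAt_target_mem_nhds (I := model V r) (P.zero x)] with z hz
      using S.linearFun_symm X (P.zero x) hz
  have hC : ContDiffAt ℝ ∞ (fun z => S.coord (P.frameAt x) ((extChartAt 𝓘(ℝ, V) x).symm z)
        (X ((extChartAt 𝓘(ℝ, V) x).symm z))) (extChartAt 𝓘(ℝ, V) x x) := by
    refine (S.contDiffOn_coord x (hX.mono (subset_univ _))).contDiffAt ?_
    refine Filter.inter_mem (extChartAt_target_mem_nhds x)
      ((continuousAt_extChartAt_symm x).preimage_mem_nhds ?_)
    rw [extChartAt_to_inv]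
    exact (P.frameAt x).isOpen_baseSet.mem_nhds (mem_frameAt x)
  rw [(model V r).range_eq_univ, fderivWithin_univ, h2.fderiv_eq, extChartAt_zero] at h1
  refine (congrArg (fun L : V × (Fin r → ℝ) →L[ℝ] ℝ => L w) h1).trans ?_
  refine (fderiv_sum_snd_mul (g := fun z => S.coord (P.frameAt x) ((extChartAt 𝓘(ℝ, V) x).symm z)
        (X ((extChartAt 𝓘(ℝ, V) x).symm z))) (hC.differentiableAt (by simp)) w).trans ?_
  rw [extChartAt_to_inv]

/-- Along the zero section, the contraction of `ω_{E^*}` with a vector field tangent to the zero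
section. -/
lemma omega_zero {X : VField 𝓘(ℝ, V) Y} (hX : SmoothOn 𝓘(ℝ, V) X univ) (x : Y)
    (w : TangentSpace (model V r) (P.zero x)) :
    S.omega (P.zero x) ![mfderiv 𝓘(ℝ, V) (model V r) P.zero x (X x), w] =
      (P.pullback (Form.interior 𝓘(ℝ, V) X P.form) +
        Form.dFun (model V r) (S.linearFun X)) (P.zero x) ![w] := by
  have h1 : (mfderiv 𝓘(ℝ, V) (model V r) P.zero x (X x) : V × (Fin r → ℝ)) = (X x, 0) :=
    mfderiv_zero_apply (V := V) (P := P) x (X x)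
  have h2 := S.d_theta_zero x (mfderiv 𝓘(ℝ, V) (model V r) P.zero x (X x)) w
  have h3 := S.dFun_linearFun_zero hX x w
  have h4 : P.pullback P.form (P.zero x) ![mfderiv 𝓘(ℝ, V) (model V r) P.zero x (X x), w] =
      P.pullback (Form.interior 𝓘(ℝ, V) X P.form) (P.zero x) ![w] := by
    refine congrArg (P.form x) (funext fun i => ?_)
    fin_cases i
    · exact (mfderiv_proj_apply (P.zero x) _).trans (congrArg Prod.fst h1)
    · rfl
  -- The vector `To(X)` has zero fibre component, so the first sum in `d_theta_zero` vanishes and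
  -- the second is `dF`.
  have h5 : S.theta.d (model V r) (P.zero x)
      ![mfderiv 𝓘(ℝ, V) (model V r) P.zero x (X x), w] =
      - Form.dFun (model V r) (S.linearFun X) (P.zero x) ![w] := by
    refine h2.trans (Eq.trans ?_ (congrArg Neg.neg h3).symm)
    have h6 : ∀ u : V × (Fin r → ℝ), u = (X x, 0) →
        ∑ i, u.2 i * S.coord (P.frameAt x) x (w : V × (Fin r → ℝ)).1 i -
          ∑ i, (w : V × (Fin r → ℝ)).2 i * S.coord (P.frameAt x) x u.1 i =
        - ∑ i, (w : V × (Fin r → ℝ)).2 i * S.coord (P.frameAt x) x (X x) i := by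
      rintro u rfl
      simp
    exact h6 _ h1
  change P.pullback P.form (P.zero x) _ - S.theta.d (model V r) (P.zero x) _ =
    P.pullback (Form.interior 𝓘(ℝ, V) X P.form) (P.zero x) _ +
      Form.dFun (model V r) (S.linearFun X) (P.zero x) _
  rw [h4, h5, sub_neg_eq_add]

/-- A smooth vector field on `Y` extends to a vector field on a symplectic thickening, whose
contraction with the symplectic form is the pullback of the contraction on `Y`, up to an exact
form. -/
theorem exists_extends {U : Set P.EStar} (hU : S.IsThickening U) {X : VField 𝓘(ℝ, V) Y}
    (hX : SmoothOn 𝓘(ℝ, V) X univ) :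
    ∃ Z : VField (model V r) P.EStar, SmoothOn (model V r) Z U ∧
      (∀ a ∈ U, Form.interior (model V r) Z S.omega a =
        (P.pullback (Form.interior 𝓘(ℝ, V) X P.form) +
          Form.dFun (model V r) (S.linearFun X)) a) ∧ Extends P Z X := by
  obtain ⟨Z, hZ, hZU⟩ := exists_interior_eq S.smooth_omega
    ((smooth_pullback (P := P) (P.smooth.interior hX)).add
      (Form.smooth_dFun (S.contMDiff_linearFun hX))) hU.isOpen hU.nondegenerate
  refine ⟨Z, hZ, hZU, fun x => ?_⟩
  -- Two vectors with the same contraction differ by a null vector, and there is none but `0` at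
  -- points of `U`.
  rw [← sub_eq_zero, ← Submodule.mem_bot ℝ, ← hU.nondegenerate _ (hU.zero_mem x)]
  intro w
  have h1 : S.omega (P.zero x) ![Z (P.zero x), w] =
      S.omega (P.zero x) ![mfderiv 𝓘(ℝ, V) (model V r) P.zero x (X x), w] :=
    (congrArg (fun β : TangentSpace (model V r) (P.zero x) [⋀^Fin 1]→L[ℝ] ℝ => β ![w])
      (hZU _ (hU.zero_mem x))).trans (S.omega_zero hX x w).symm
  let B := Form.bilin (E := V × (Fin r → ℝ)) (S.omega (P.zero x))
  have h2 : ∀ v w, B v w = S.omega (P.zero x) ![v, w] :=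
    Form.bilin_apply (E := V × (Fin r → ℝ)) (S.omega (P.zero x))
  refine (h2 _ w).symm.trans ?_
  refine (congrArg (fun f : V × (Fin r → ℝ) →L[ℝ] ℝ => f w) (B.map_sub _ _)).trans ?_
  exact sub_eq_zero.2 (((h2 _ w).trans h1).trans (h2 _ w).symm)

end Splitting

end PresymplecticForm
end Presymplectic

/-! ### The extension theorem. -/

theorem mainTheorem9 {V : Type*} [NormedAddCommGroup V] [NormedSpace ℝ V] [FiniteDimensional ℝ V]
    {Y : Type*} [TopologicalSpace Y] [ChartedSpace V Y] [IsManifold 𝓘(ℝ, V) ∞ Y] {r : ℕ}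
    (P : Presymplectic.PresymplecticForm V Y r) (S : P.Splitting)
    (U : Set P.EStar) (hU : S.IsThickening U)
    (ξ : Presymplectic.VField 𝓘(ℝ, V) Y) (hξ : Presymplectic.SmoothOn 𝓘(ℝ, V) ξ univ) :
    (Presymplectic.IsLocallyHamiltonianOn 𝓘(ℝ, V) P.form ξ univ →
      ∃ Ξ : Presymplectic.VField (Presymplectic.PresymplecticForm.model V r) P.EStar,
        Presymplectic.SmoothOn (Presymplectic.PresymplecticForm.model V r) Ξ U ∧
        Presymplectic.IsLocallyHamiltonianOn (Presymplectic.PresymplecticForm.model V r)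
          S.omega Ξ U ∧
        Presymplectic.Extends P Ξ ξ) ∧
    (Presymplectic.IsHamiltonianOn 𝓘(ℝ, V) P.form ξ univ →
      ∃ Ξ : Presymplectic.VField (Presymplectic.PresymplecticForm.model V r) P.EStar,
        Presymplectic.SmoothOn (Presymplectic.PresymplecticForm.model V r) Ξ U ∧
        Presymplectic.IsHamiltonianOn (Presymplectic.PresymplecticForm.model V r)
          S.omega Ξ U ∧
        Presymplectic.Extends P Ξ ξ) := by
  obtain ⟨Ξ, hΞ, hΞU, hext⟩ := S.exists_extends hU hξ
  have hF := S.contMDiff_linearFun hξ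
  refine ⟨fun h => ⟨Ξ, hΞ, fun a ha => ?_, hext⟩, ?_⟩
  · have hα := P.smooth.interior hξ
    -- Near `a` the contraction is `π^*(ξ ⌟ ω) + dF`, and `d` annihilates each summand at `a`.
    rw [Presymplectic.Form.d_congr (Filter.eventually_of_mem (hU.isOpen.mem_nhds ha) hΞU),
      Presymplectic.Form.d_add (Presymplectic.PresymplecticForm.smooth_pullback hα)
        (Presymplectic.Form.smooth_dFun hF),
      Presymplectic.PresymplecticForm.d_pullback hα a (h _ (mem_univ _)),
      Presymplectic.Form.d_dFun hF, add_zero]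
  · rintro ⟨f, hf, hfξ⟩
    have hfs : ContMDiff 𝓘(ℝ, V) 𝓘(ℝ, ℝ) ∞ f := contMDiffOn_univ.1 hf
    have hπ := Presymplectic.PresymplecticForm.contMDiff_proj (P := P)
    -- The Hamiltonian is `f ∘ π + F`: the pulled-back Hamiltonian of `ξ`, corrected by the function
    -- linear on the fibres.
    refine ⟨Ξ, hΞ, ⟨f ∘ P.proj + S.linearFun ξ, ((hfs.comp hπ).add hF).contMDiffOn,
      fun a ha => ?_⟩, hext⟩
    rw [hΞU a ha]
    ext w
    have h1 := mfderiv_comp a (hfs.mdifferentiable (by simp) (P.proj a))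
      (hπ.mdifferentiable (by simp) a)
    have h2 := mfderiv_add ((hfs.comp hπ).mdifferentiable (by simp) a)
      (hF.mdifferentiable (by simp) a)
    have h3 : P.pullback (Presymplectic.Form.interior 𝓘(ℝ, V) ξ P.form) a w =
        mfderiv (Presymplectic.PresymplecticForm.model V r) 𝓘(ℝ, ℝ) (f ∘ P.proj) a (w 0) := by
      rw [h1]
      exact congrArg (fun β : TangentSpace 𝓘(ℝ, V) a.1 [⋀^Fin 1]→L[ℝ] ℝ =>
        β (fun i => mfderiv (Presymplectic.PresymplecticForm.model V r) 𝓘(ℝ, V) P.proj a (w i))) (hfξ a.1 (mem_univ _))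
    refine Eq.trans ?_ (congrArg (fun L : V × (Fin r → ℝ) →L[ℝ] ℝ => L (w 0)) h2).symm
    exact congrArg (· + Presymplectic.Form.dFun (Presymplectic.PresymplecticForm.model V r) (S.linearFun ξ) a w) h3
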